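/- **Theorem.** For a rational $r>0$ let $\mathbb{Q}(\sqrt[*]{r})\subseteq\mathbb{R}$ be the field obtained from $\mathbb{Q}$ by adjoining the positive real roots $r^{1/n}$ for all integers $n\ge 1$. Let $\mathbb{R}^\infty=\bigsqcup_{k\ge 0}\mathbb{R}^k$ be the set of all finite sequences of real numbers, and regard subsets of $\mathbb{R}=\mathbb{R}^1$ as subsets of $\mathbb{R}^\infty$. Consider Blum–Shub–Smale (BSS) machines over $\mathbb{R}$: finite programs that operate on registers holding real numbers, with instructions for the arithmetic operations $+,-,\cdot,:$ on registers, for loading real constants, for branching on whether a register is $\ge 0$, and for copying between indirectly addressed registers; inputs and outputs are elements of $\mathbb{R}^\infty$. A set $A\subseteq\mathbb{R}^\infty$ is *semi-decidable* (recursively enumerable) if some BSS machine, on inputs from $\mathbb{R}^\infty$, halts precisely on the elements of $A$. A set $A$ is *reducible* to $B\subseteq\mathbb{R}^\infty$ if some BSS oracle machine, which in addition may ask whether a finite sequence of real numbers computed so far belongs to $B$, computes the characteristic function of $A$ on $\mathbb{R}^\infty$. Then $\mathbb{Q}(\sqrt[*]{2})$ and $\mathbb{Q}(\sqrt[*]{3})$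 are both semi-decidable, and they are incomparable: $\mathbb{Q}(\sqrt[*]{2})$ is not reducible to $\mathbb{Q}(\sqrt[*]{3})$, and $\mathbb{Q}(\sqrt[*]{3})$ is not reducible to $\mathbb{Q}(\sqrt[*]{2})$. -/

import Mathlib

/-! ### Blum-Shub-Smale machines over the reals, with oracle nodes -/

namespace BSS

/-- The space `ℝ^∞` of all finite sequences of real numbers (with their length). -/
abbrev Seq : Type := List ℝ

/-- A real number decision problem: a subset of `ℝ^∞`. -/
abbrev Problem : Type := Set Seq

/-- The arithmetic operations `+, -, *, :`. -/
inductive ArithOp : Type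
  | add
  | sub
  | mul
  | div

/-- The value of an arithmetic operation; a division by zero is undefined. -/
noncomputable def ArithOp.eval : ArithOp → ℝ → ℝ → Option ℝ
  | .add, a, b => some (a + b)
  | .sub, a, b => some (a - b)
  | .mul, a, b => some (a * b)
  | .div, a, b => if b = 0 then none else some (a / b)

/-- What a computation instruction does to a copy-register (an address in `ℕ`). -/
inductive AddrOp : Type
  | keep
  | incr
  | reset

def AddrOp.eval : AddrOp → ℕ → ℕ
  | .keep, a => a
  | .incr, a => a + 1
  | .reset, _ => 0

/-- The instructions of a machine. `u` and `v` act on the copy-registers `i` and `j`.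
* `arith s op k l u v` : `x_s ← x_k op x_l`, go to the next instruction;
* `load s α u v` : `x_s ← α` for a real constant `α`, go to the next instruction;
* `branch t` : if `x_0 ≥ 0` go to `t`, else go to the next instruction;
* `copy` : `x_i ← x_j`, go to the next instruction;
* `oracle t` : if the sequence `(x_i, x_{i+1}, …, x_{j-1})` belongs to the oracle set go to `t`,
  else go to the next instruction. -/
inductive Instr : Type
  | arith (s : ℤ) (op : ArithOp) (k l : ℤ) (u v : AddrOp)
  | load (s : ℤ) (α : ℝ) (u v : AddrOp)
  | branch (t : ℕ)
  | copy
  | oracle (t : ℕ)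

/-- The jump targets of an instruction. -/
def Instr.targets : Instr → Set ℕ
  | .branch t => {t}
  | .oracle t => {t}
  | _ => ∅

def Instr.IsOracle : Instr → Prop
  | .oracle _ => True
  | _ => False

/-- A configuration: the current instruction, the copy-registers `i` (write) and `j` (read), and
the contents of the registers. The registers `x_0, x_1, …` can be addressed indirectly through `i`
and `j`; the registers `x_{-1}, x_{-2}, …` only directly, by the instructions that name them. -/
structure Config : Type where
  label : ℕ
  i : ℕ
  j : ℕ
  reg : ℤ → ℝ

/-- The sequence `(x_i, x_{i+1}, …, x_{j-1})` (empty if `j ≤ i`). -/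
def Config.query (c : Config) : Seq :=
  (List.range (c.j - c.i)).map fun m => c.reg ((c.i : ℤ) + (m : ℤ))

open Classical in
/-- The effect of one instruction on a configuration, with oracle set `B`; undefined for a division
by zero. -/
noncomputable def Instr.exec (B : Problem) (c : Config) : Instr → Option Config
  | .arith s op k l u v =>
      (op.eval (c.reg k) (c.reg l)).map fun r =>
        ⟨c.label + 1, u.eval c.i, v.eval c.j, Function.update c.reg s r⟩
  | .load s α u v =>
      some ⟨c.label + 1, u.eval c.i, v.eval c.j, Function.update c.reg s α⟩
  | .branch t =>
      some { c with label := if 0 ≤ c.reg 0 then t else c.label + 1 }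
  | .copy =>
      some { c with label := c.label + 1, reg := Function.update c.reg (c.i : ℤ) (c.reg (c.j : ℤ)) }
  | .oracle t =>
      some { c with label := if c.query ∈ B then t else c.label + 1 }

/-- A BSS oracle machine: a finite program. The labels are `0, …, code.length`; the computation
starts at label `0` and stops at label `code.length`, and every jump goes to a label. -/
structure Machine : Type where
  code : List Instr
  valid : ∀ I ∈ code, ∀ t ∈ I.targets, t ≤ code.length

/-- An (ordinary) BSS machine is one without oracle nodes. -/
def Machine.OracleFree (M : Machine) : Prop :=
  ∀ I ∈ M.code, ¬ I.IsOracle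

/-- The initial configuration on input `y = (y_1, …, y_k)`: both copy-registers are `1`, the
registers `x_1, …, x_k` hold `y`, the register `x_0` holds the length `k`, and all other registers
hold `0`. -/
noncomputable def init (y : Seq) : Config where
  label := 0
  i := 1
  j := 1
  reg := fun z =>
    if z = 0 then (y.length : ℝ) else if 0 < z then y.getD (z.toNat - 1) 0 else 0

/-- The successor configuration, if there is one. -/
noncomputable def Machine.step (M : Machine) (B : Problem) (c : Config) : Option Config :=
  (M.code[c.label]?).bind (Instr.exec B c)

/-- With oracle set `B`, the machine stops on input `y` in the configuration `c`. -/
def Machine.StopsIn (M : Machine) (B : Problem) (y : Seq) (c : Config) : Prop :=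
  Relation.ReflTransGen (fun c₁ c₂ => M.step B c₁ = some c₂) (init y) c ∧
    c.label = M.code.length

/-- With oracle set `B`, the machine halts on input `y`. -/
def Machine.Halts (M : Machine) (B : Problem) (y : Seq) : Prop :=
  ∃ c, M.StopsIn B y c

/-- The output of a stopped computation is read like an input: `x_0` is the length of the output
sequence and `x_1, x_2, …` are its entries. -/
def Config.HasOutput (c : Config) (w : Seq) : Prop :=
  c.reg 0 = (w.length : ℝ) ∧
    ∀ (m : ℕ) (hm : m < w.length), c.reg ((m : ℤ) + 1) = w[m]

/-- With oracle set `B`, the machine computes `f` on the set `Y` of admissible inputs. -/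
def Machine.Computes (M : Machine) (B : Problem) (Y : Set Seq) (f : Seq → Seq) : Prop :=
  ∀ y ∈ Y, ∃ c, M.StopsIn B y c ∧ c.HasOutput (f y)

/-- The characteristic function of a decision problem, with values in `ℝ^1 ⊆ ℝ^∞`. -/
noncomputable def charFun (A : Problem) (y : Seq) : Seq :=
  [A.indicator (fun _ => (1 : ℝ)) y]

/-- `A` is semi-decidable (recursively enumerable): some BSS machine (without oracle nodes, so that
the oracle set plays no role) halts precisely on the inputs that belong to `A`. -/
def SemiDecidable (A : Problem) : Prop :=
  ∃ M : Machine, M.OracleFree ∧ ∀ y : Seq, M.Halts ∅ y ↔ y ∈ A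

/-- `A ⪯ B`: some BSS oracle machine decides membership in `A` by using `B` as oracle set. -/
def Reducible (A B : Problem) : Prop :=
  ∃ M : Machine, M.Computes B Set.univ (charFun A)

/-- Neither of the two problems is reducible to the other. -/
def Incomparable (A B : Problem) : Prop :=
  ¬ Reducible A B ∧ ¬ Reducible B A

/-- A set of real numbers, regarded as a subset of `ℝ^1 ⊆ ℝ^∞`. -/
def ofReals (S : Set ℝ) : Problem :=
  {y | ∃ x ∈ S, y = [x]}

end BSS

/-- The subfield of `ℝ` obtained from `ℚ` by adjoining all positive real roots `r^(1/n)`, `n ≥ 1`,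
of a rational `r > 0`. -/
noncomputable def adjoinAllRoots (r : ℚ) : IntermediateField ℚ ℝ :=
  IntermediateField.adjoin ℚ {x : ℝ | ∃ n : ℕ, 0 < n ∧ x = (r : ℝ) ^ ((1 : ℝ) / (n : ℝ))}

/-! Semi-decidability uses that a machine may contain an arbitrary real constant. Every element of
such a field is algebraic, so the field is countable, and each element `s` is singled out by an
equation `p(x) = 0` and an inequality `r(x) ≥ 0` with integer polynomials. Programs evaluating these
polynomials for all `s`, one after another, are written into the decimal digits of one constant. A
fixed program, `interpreter`, reads the digits and stops once a test succeeds
(`semiDecidable_ofReals`). For non-reducibility, suppose a machine reduces the field `A` of roots of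
`p` to the field `S` of roots of `q`, and let `L` be generated by `S` and the constants of the
machine. Run it on an input `x₀` transcendental over `L`; then `x₀ ∉ A`, so the output is `0`. Along
this run all registers are rational functions of the input over `L`. An input close to `x₀` and of
large degree over `L` takes the same path: signs persist by continuity, and a nonconstant rational
function takes no value in `S ⊆ L` there (`IsGenericallyRational.eventually_mem_iff`). So the output
is again `0`, and it remains to find such inputs in `A` (`frequently_mem_adjoinAllRoots`). They
exist because the roots `p^(1/n)` have unbounded degree over `L`: otherwise a norm argument puts all
of them into `L` (`rpow_one_div_mem_of_natDegree_minpoly_le`). But `√p ∉ S`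
(`sqrt_prime_notMem_adjoinAllRoots`), and adjoining finitely many reals to a field lacking some root
never yields all roots (`exists_countable_subfield_insert`). -/

section

/-! ### Degrees of real roots, and square roots of primes in radical extensions -/

open Polynomial IntermediateField

/-- If a power of `a > 0` lies in a subfield, then so does the absolute value of the norm of `a`,
which is a power of `a`. -/
theorem exists_algebraMap_eq_pow_natDegree_minpoly {F : Type*} [Field F] [Algebra F ℝ] {a : ℝ}
    (ha : 0 < a) {n : ℕ} (hn : 0 < n) {b : F} (hb : algebraMap F ℝ b = a ^ n) :
    ∃ c : F, algebraMap F ℝ c = a ^ (minpoly F a).natDegree := by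
  have hroot : aeval a (X ^ n - C b) = 0 := by simp [hb]
  have hint : IsIntegral F a := ⟨X ^ n - C b, monic_X_pow_sub_C b hn.ne', by
    simpa [aeval_def] using hroot⟩
  have hdvd : minpoly F a ∣ X ^ n - C b := minpoly.dvd F a hroot
  set φ : F →+* ℂ := Complex.ofRealHom.comp (algebraMap F ℝ) with hφ
  have hmonic : ((minpoly F a).map φ).Monic := (minpoly.monic hint).map φ
  have hsplit : ((minpoly F a).map φ).Splits := IsAlgClosed.splits _
  have hcoeff := hsplit.coeff_zero_eq_prod_roots_of_monic hmonic
  -- The conjugates of `a` are roots of `X ^ n - a ^ n`, so all have absolute value `a`; their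
  -- product is, up to sign, the constant coefficient.
  have hnorm : ∀ ρ ∈ ((minpoly F a).map φ).roots, ‖ρ‖ = a := by
    intro ρ hρ
    have h1 : (X ^ n - C b : F[X]).map φ |>.IsRoot ρ :=
      (isRoot_of_mem_roots hρ).dvd (Polynomial.map_dvd φ hdvd)
    have h2 : ρ ^ n = (a : ℂ) ^ n := by
      have h3 : ρ ^ n - φ b = 0 := by simpa [IsRoot] using h1
      have h4 : φ b = (a : ℂ) ^ n := by simp [hφ, hb]
      rw [sub_eq_zero.1 h3, h4]
    have h5 : ‖ρ‖ ^ n = a ^ n := by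
      rw [← norm_pow, h2, norm_pow, Complex.norm_real, Real.norm_of_nonneg ha.le]
    exact (pow_left_inj₀ (norm_nonneg _) ha.le hn.ne').1 h5
  have hprod : ‖((minpoly F a).map φ).roots.prod‖ = a ^ (minpoly F a).natDegree := by
    have h6 : (((minpoly F a).map φ).roots.map (fun ρ => ‖ρ‖)).prod
        = a ^ (minpoly F a).natDegree := by
      rw [Multiset.map_congr rfl hnorm, Multiset.map_const', Multiset.prod_replicate,
        ← hsplit.natDegree_eq_card_roots, natDegree_map]
    rw [← h6]
    exact map_multiset_prod (normHom : ℂ →*₀ ℝ) _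
  have habs : |algebraMap F ℝ ((minpoly F a).coeff 0)| = a ^ (minpoly F a).natDegree := by
    have h7 := congrArg norm hcoeff
    rw [coeff_map] at h7
    rw [← hprod, ← Real.norm_eq_abs, ← Complex.norm_real]
    simpa [hφ] using h7
  rcases abs_choice (algebraMap F ℝ ((minpoly F a).coeff 0)) with h | h
  · exact ⟨_, h ▸ habs⟩
  · exact ⟨-(minpoly F a).coeff 0, by rw [map_neg, ← h, habs]⟩

theorem mul_eq_of_rat_pow_eq_prime_pow {p : ℕ} (hp : p.Prime) {q : ℚ} {m e : ℕ}
    (h : q ^ m = (p : ℚ) ^ e) : (m : ℤ) * padicValRat p q = e := by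
  have := Fact.mk hp
  have h1 := congrArg (padicValRat p) h
  rwa [padicValRat.pow, padicValRat.pow, padicValRat.self hp.one_lt, mul_one] at h1

/-- The degree over `ℚ` of an `m`-th root of a prime number. -/
theorem natDegree_minpoly_of_pow_eq_prime {p : ℕ} (hp : p.Prime) {t : ℝ} (ht : 0 < t) {m : ℕ}
    (hm : 0 < m) (h : t ^ m = p) : (minpoly ℚ t).natDegree = m := by
  obtain ⟨c, hc⟩ := exists_algebraMap_eq_pow_natDegree_minpoly (F := ℚ) ht hm (b := (p : ℚ))
    (by simp [h])
  have hroot : aeval t (X ^ m - C (p : ℚ)) = 0 := by simp [h]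
  have hmon : (X ^ m - C (p : ℚ)).Monic := monic_X_pow_sub_C _ hm.ne'
  have hint : IsIntegral ℚ t := ⟨_, hmon, by simpa [aeval_def] using hroot⟩
  have hle : (minpoly ℚ t).natDegree ≤ m := by
    have := natDegree_le_of_dvd (minpoly.dvd ℚ t hroot) hmon.ne_zero
    rwa [natDegree_X_pow_sub_C] at this
  -- For the rational `c = t ^ deg`, comparing `p`-adic valuations in this identity shows that `m`
  -- divides the degree.
  have hpow : c ^ m = (p : ℚ) ^ (minpoly ℚ t).natDegree := by
    have : (c : ℝ) ^ m = (p : ℝ) ^ (minpoly ℚ t).natDegree := by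
      rw [← h, ← pow_mul, mul_comm, pow_mul, ← hc]; rfl
    exact_mod_cast this
  have hv := mul_eq_of_rat_pow_eq_prime_pow hp hpow
  have hdvd : m ∣ (minpoly ℚ t).natDegree := by
    have : (m : ℤ) ∣ ((minpoly ℚ t).natDegree : ℤ) := ⟨_, hv.symm⟩
    exact_mod_cast this
  exact le_antisymm hle (Nat.le_of_dvd (minpoly.natDegree_pos hint) hdvd)

/-- Squaring `√p = b √q + a` gives `a b = 0`, since `√q` is irrational. If `a = 0`, then `p = b² q`
has an odd `p`-adic valuation on the left and an even one on the right; if `b = 0`, then `√p` is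
rational. -/
theorem sqrt_prime_notMem_adjoin_sqrt_prime {p q : ℕ} (hp : p.Prime) (hq : q.Prime) (hpq : p ≠ q) :
    √(p : ℝ) ∉ ℚ⟮√(q : ℝ)⟯ := by
  intro hmem
  have hq2 : √(q : ℝ) ^ 2 = q := Real.sq_sqrt (Nat.cast_nonneg _)
  have hp2 : √(p : ℝ) ^ 2 = p := Real.sq_sqrt (Nat.cast_nonneg _)
  have hroot : aeval √(q : ℝ) (X ^ 2 - C (q : ℚ)) = 0 := by simp
  have hmon : (X ^ 2 - C (q : ℚ)).Monic := monic_X_pow_sub_C _ two_ne_zero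
  have hint : IsIntegral ℚ √(q : ℝ) := ⟨_, hmon, by rw [← aeval_def, hroot]⟩
  have h1 : √(p : ℝ) ∈ Algebra.adjoin ℚ {√(q : ℝ)} := by
    rw [← adjoin_simple_toSubalgebra_of_isAlgebraic hint.isAlgebraic]; exact hmem
  rw [Algebra.adjoin_singleton_eq_range_aeval] at h1
  obtain ⟨f, hf⟩ := h1
  have hdeg : (f %ₘ (X ^ 2 - C (q : ℚ))).natDegree ≤ 1 := by
    have := natDegree_modByMonic_lt f hmon (by
      intro h; have := congrArg natDegree h; rw [natDegree_X_pow_sub_C] at this; simp at this)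
    rw [natDegree_X_pow_sub_C] at this; omega
  obtain ⟨b, a, hab⟩ := exists_eq_X_add_C_of_natDegree_le_one hdeg
  have hval : √(p : ℝ) = b * √(q : ℝ) + a := by
    have h2 := aeval_modByMonic_eq_self_of_root (p := f) hroot
    rw [hab] at h2
    have h3 : aeval √(q : ℝ) f = √(p : ℝ) := hf
    rw [← h3, ← h2]; simp
  have hsq : (p : ℝ) = b ^ 2 * q + a ^ 2 + 2 * a * b * √(q : ℝ) := by
    rw [← hp2, hval]; linear_combination (b : ℝ) ^ 2 * hq2
  have hirr : Irrational √(q : ℝ) := hq.irrational_sqrt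
  have hirr' : Irrational √(p : ℝ) := hp.irrational_sqrt
  have hab0 : a * b = 0 := by
    by_contra hne
    have hne' : (2 * a * b : ℚ) ≠ 0 := by
      intro h; apply hne; linear_combination h / 2
    refine hirr ⟨(p - b ^ 2 * q - a ^ 2) / (2 * a * b), ?_⟩
    have hne'' : (2 * a * b : ℝ) ≠ 0 := by exact_mod_cast hne'
    push_cast
    rw [div_eq_iff hne'', hsq]; ring
  rcases mul_eq_zero.1 hab0 with h0 | h0
  · have hb : (p : ℚ) = b ^ 2 * q := by
      rw [h0] at hsq
      have : (p : ℝ) = b ^ 2 * q := by simpa using hsq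
      exact_mod_cast this
    have := Fact.mk hp
    have hb0 : b ≠ 0 := by
      rintro rfl
      simp [hp.ne_zero] at hb
    have h4 := congrArg (padicValRat p) hb
    rw [padicValRat.self hp.one_lt, padicValRat.mul (pow_ne_zero _ hb0)
      (Nat.cast_ne_zero.2 hq.ne_zero), padicValRat.pow] at h4
    have h5 : padicValRat p (q : ℚ) = 0 := by
      rw [padicValRat.of_nat]
      exact_mod_cast padicValNat.eq_zero_of_not_dvd fun h =>
        hpq ((Nat.prime_dvd_prime_iff_eq hp hq).1 h)
    rw [h5] at h4
    push_cast at h4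
    omega
  · exact hirr' ⟨a, by rw [hval, h0]; simp⟩

/-- The tower law for `K ⊆ K(b) ⊆ K(a)`, where `K(b)(a) = K(a)`. -/
theorem finrank_mul_natDegree_minpoly {K E : Type*} [Field K] [Field E] [Algebra K E] {a b : E}
    (ha : IsIntegral K a) (hb : IsIntegral K b) (hba : b ∈ K⟮a⟯) :
    Module.finrank K K⟮b⟯ * (minpoly K⟮b⟯ a).natDegree = Module.finrank K K⟮a⟯ := by
  have hfield : (K⟮b⟯⟮a⟯).restrictScalars K = K⟮a⟯ := by
    rw [adjoin_simple_adjoin_simple]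
    apply le_antisymm
    · rw [adjoin_le_iff]
      rintro x (rfl | rfl)
      · exact hba
      · exact mem_adjoin_simple_self K x
    · exact adjoin.mono _ _ _ (by simp)
  rw [← adjoin.finrank (ha.tower_top : IsIntegral K⟮b⟯ a),
    Module.finrank_mul_finrank K K⟮b⟯ K⟮b⟯⟮a⟯, ← hfield]
  rfl

/-- If `√p ∈ ℚ(t)` for a `2k`-th root `t` of `q`, then `√q ∈ ℚ(√p)`. -/
theorem sqrt_prime_notMem_adjoin_root {p q : ℕ} (hp : p.Prime) (hq : q.Prime) (hpq : p ≠ q)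
    {t : ℝ} (ht : 0 < t) {k : ℕ} (hk : 0 < k) (h : t ^ (2 * k) = q) :
    √(p : ℝ) ∉ ℚ⟮t⟯ := by
  intro hmem
  have hm : 0 < 2 * k := by omega
  have hp2 : √(p : ℝ) ^ 2 = p := Real.sq_sqrt (Nat.cast_nonneg _)
  have hd1 : (minpoly ℚ t).natDegree = 2 * k := natDegree_minpoly_of_pow_eq_prime hq ht hm h
  have hd2 : (minpoly ℚ √(p : ℝ)).natDegree = 2 :=
    natDegree_minpoly_of_pow_eq_prime hp (Real.sqrt_pos.2 (Nat.cast_pos.2 hp.pos)) two_pos hp2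
  have hi1 : IsIntegral ℚ t := by
    by_contra hc; rw [minpoly.eq_zero hc] at hd1; simp at hd1; omega
  have hi2 : IsIntegral ℚ √(p : ℝ) := by
    by_contra hc; rw [minpoly.eq_zero hc] at hd2; simp at hd2
  have hf2 := finrank_mul_natDegree_minpoly hi1 hi2 hmem
  rw [adjoin.finrank hi2, adjoin.finrank hi1, hd1, hd2] at hf2
  -- The degree `2k` of `t` over `ℚ` splits as `2 · k`, so the norm argument over `ℚ(√p)` puts `t ^
  -- k = √q` into that field.
  have hd3 : (minpoly ℚ⟮√(p : ℝ)⟯ t).natDegree = k := by omega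
  obtain ⟨c, hc⟩ := exists_algebraMap_eq_pow_natDegree_minpoly (F := ℚ⟮√(p : ℝ)⟯) ht hm
    (b := (q : ℚ⟮√(p : ℝ)⟯)) (by simp [h])
  rw [hd3] at hc
  have hs : t ^ k = √(q : ℝ) := by
    rw [eq_comm, Real.sqrt_eq_iff_mul_self_eq (Nat.cast_nonneg _) (pow_pos ht k).le, ← h]
    ring
  rw [hs] at hc
  exact sqrt_prime_notMem_adjoin_sqrt_prime hq hp hpq.symm (hc ▸ c.2)

theorem rpow_one_div_pow {r : ℝ} (hr : 0 ≤ r) {n m k : ℕ} (hn : 0 < n) (h : n * k = m)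
    (hm : 0 < m) : (r ^ ((1 : ℝ) / (m : ℝ))) ^ k = r ^ ((1 : ℝ) / (n : ℝ)) := by
  rw [← Real.rpow_natCast, ← Real.rpow_mul hr]
  congr 1
  have : (n : ℝ) ≠ 0 := by positivity
  have h2 : (m : ℝ) ≠ 0 := by positivity
  rw [← h] at h2 ⊢
  push_cast at h2 ⊢
  have : (k : ℝ) ≠ 0 := right_ne_zero_of_mul h2
  field_simp

theorem sqrt_prime_notMem_adjoinAllRoots {p q : ℕ} (hp : p.Prime) (hq : q.Prime) (hpq : p ≠ q) :
    √(p : ℝ) ∉ adjoinAllRoots q := by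
  intro hmem
  obtain ⟨T, hT, hmemT⟩ := exists_finset_of_mem_adjoin hmem
  have hex : ∀ x : T, ∃ n : ℕ, 0 < n ∧ (x : ℝ) = ((q : ℚ) : ℝ) ^ ((1 : ℝ) / (n : ℝ)) :=
    fun x => hT x.2
  choose n hn hx using hex
  -- Membership involves only finitely many roots, and all of them are powers of the single root
  -- `q^(1/(2k))`; the factor `2` supplies the even exponent required of that root.
  set k := ∏ x, n x with hk
  have hkpos : 0 < k := Finset.prod_pos fun x _ => hn x
  have hq0 : (0 : ℝ) < ((q : ℚ) : ℝ) := by exact_mod_cast hq.pos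
  set t : ℝ := ((q : ℚ) : ℝ) ^ ((1 : ℝ) / ((2 * k : ℕ) : ℝ)) with ht
  have htpow : t ^ (2 * k) = q := by
    rw [ht, rpow_one_div_pow hq0.le one_pos (one_mul _) (by omega)]
    simp
  refine sqrt_prime_notMem_adjoin_root hp hq hpq (Real.rpow_pos_of_pos hq0 _) hkpos htpow ?_
  refine (adjoin_le_iff.2 ?_ : adjoin ℚ (T : Set ℝ) ≤ ℚ⟮t⟯) hmemT
  intro x hxT
  obtain ⟨l, hl⟩ := Finset.dvd_prod_of_mem n (Finset.mem_univ (⟨x, hxT⟩ : T))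
  have hx' := hx ⟨x, hxT⟩
  rw [← rpow_one_div_pow hq0.le (hn ⟨x, hxT⟩) (m := 2 * k) (k := 2 * l) (by rw [hk, hl]; ring)
    (by omega)] at hx'
  change x = _ at hx'
  rw [hx']
  exact pow_mem (mem_adjoin_simple_self ℚ t) _

/-! ### Countable subfields that miss some of the roots -/

/-- A subfield over which all the roots `r^(1/n)` have bounded degree contains all of them. -/
theorem rpow_one_div_mem_of_natDegree_minpoly_le {r : ℝ} (hr : 0 < r) (L : Subfield ℝ) (hrL : r ∈ L)
    (D : ℕ) (hD : ∀ n : ℕ, 0 < n → (minpoly L (r ^ ((1 : ℝ) / (n : ℝ)))).natDegree ≤ D) (N : ℕ)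
    (hN : 0 < N) : r ^ ((1 : ℝ) / (N : ℝ)) ∈ L := by
  -- The degree `d` of `a = r^(1/m)` over `L` is at most `D`, hence divides `D!`; since `a ^ d ∈ L`,
  -- also `a ^ D! = r^(1/N)` lies in `L`.
  set m := N * D.factorial with hm
  have hmpos : 0 < m := Nat.mul_pos hN D.factorial_pos
  set a : ℝ := r ^ ((1 : ℝ) / (m : ℝ)) with ha
  have ham : a ^ m = r := by
    rw [ha, rpow_one_div_pow hr.le one_pos (one_mul _) hmpos]; simp
  obtain ⟨c, hc⟩ := exists_algebraMap_eq_pow_natDegree_minpoly (F := L)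
    (Real.rpow_pos_of_pos hr _ : 0 < a) hmpos (b := ⟨r, hrL⟩) (by rw [ham]; rfl)
  have hint : IsIntegral L a := ⟨X ^ m - C ⟨r, hrL⟩, monic_X_pow_sub_C _ hmpos.ne', by
    rw [eval₂_sub, eval₂_X_pow, eval₂_C, ham]; exact sub_self r⟩
  obtain ⟨l, hl⟩ := Nat.dvd_factorial (minpoly.natDegree_pos hint) (hD m hmpos)
  rw [← rpow_one_div_pow hr.le hN hm.symm hmpos, hl, pow_mul, ← ha, ← hc]
  exact pow_mem c.2 _

/-- If `a = p(c)/q(c)`, then `c` is a root of `p - a q`. As `c` stays transcendental over `L(a)`,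
this polynomial vanishes, and its coefficient at the degree of `q` expresses `a` as a quotient of
elements of `L`. -/
theorem mem_of_isAlgebraic_of_mem_adjoin_of_transcendental {L : Subfield ℝ} {c a : ℝ}
    (hc : Transcendental L c) (ha : IsAlgebraic L a) (hac : a ∈ L⟮c⟯) : a ∈ L := by
  obtain ⟨p, q, hpq⟩ := (mem_adjoin_simple_iff L a).1 hac
  by_cases hq : q = 0
  · rw [hpq, hq, map_zero, div_zero]; exact zero_mem L
  have hqc : aeval c q ≠ 0 := fun h => hc ⟨q, hq, h⟩
  have hK : Transcendental L⟮a⟯ c := by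
    have : Algebra.IsAlgebraic L L⟮a⟯ := isAlgebraic_adjoin_simple ha.isIntegral
    exact hc.extendScalars L⟮a⟯
  set f : L⟮a⟯[X] := p.map (algebraMap L L⟮a⟯) - C (AdjoinSimple.gen L a) *
    q.map (algebraMap L L⟮a⟯) with hf
  have hf0 : f = 0 := by
    by_contra hne
    refine hK ⟨f, hne, ?_⟩
    rw [hf, map_sub, map_mul, aeval_map_algebraMap, aeval_map_algebraMap, aeval_C,
      AdjoinSimple.algebraMap_gen, sub_eq_zero, hpq, div_mul_cancel₀ _ hqc]
  have hcoef := congrArg (fun g => algebraMap L⟮a⟯ ℝ (g.coeff q.natDegree)) hf0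
  have h0 : (p.coeff q.natDegree : ℝ) - a * (q.leadingCoeff : ℝ) = 0 := by
    simp only [hf, coeff_sub, coeff_map, coeff_C_mul, map_sub, map_mul, coeff_zero, map_zero,
      AdjoinSimple.algebraMap_gen] at hcoef
    exact hcoef
  have hlead : (q.leadingCoeff : ℝ) ≠ 0 := by
    simpa using hq
  have : a = (p.coeff q.natDegree : ℝ) / (q.leadingCoeff : ℝ) := by
    rw [eq_div_iff hlead]; linarith
  rw [this]
  exact div_mem (p.coeff q.natDegree).2 q.leadingCoeff.2

/-- Adjoining one more real number to a countable subfield of `ℝ` that does not contain all the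
roots `r^(1/n)` gives another such subfield. -/
theorem exists_countable_subfield_insert {r : ℝ} (hr : 0 < r) (L : Subfield ℝ) (hrL : r ∈ L)
    (hcount : (L : Set ℝ).Countable) (hL : ∃ N : ℕ, 0 < N ∧ r ^ ((1 : ℝ) / (N : ℝ)) ∉ L) (c : ℝ) :
    ∃ L' : Subfield ℝ, L ≤ L' ∧ c ∈ L' ∧ (L' : Set ℝ).Countable ∧
      ∃ N : ℕ, 0 < N ∧ r ^ ((1 : ℝ) / (N : ℝ)) ∉ L' := by
  refine ⟨L⟮c⟯.toSubfield, fun x hx => L⟮c⟯.algebraMap_mem ⟨x, hx⟩, mem_adjoin_simple_self L c,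
    ?_, ?_⟩
  · have : Countable L := hcount
    have : Countable L[X] := by
      rw [← Cardinal.mk_le_aleph0_iff]
      exact cardinalMk_le_max.trans (by simp)
    refine (Set.countable_range fun f : L[X] × L[X] => aeval c f.1 / aeval c f.2).mono ?_
    intro x hx
    obtain ⟨p, q, h⟩ := (mem_adjoin_simple_iff L x).1 hx
    exact ⟨(p, q), h.symm⟩
  · by_contra! hall
    obtain ⟨N, hN, hNL⟩ := hL
    have hint : ∀ n : ℕ, 0 < n → IsIntegral L (r ^ ((1 : ℝ) / (n : ℝ))) := fun n hn =>
      ⟨X ^ n - C ⟨r, hrL⟩, monic_X_pow_sub_C _ hn.ne', by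
        rw [eval₂_sub, eval₂_X_pow, eval₂_C, rpow_one_div_pow hr.le one_pos (one_mul _) hn]
        simp only [Nat.cast_one, div_one, Real.rpow_one]
        exact sub_self r⟩
    -- If `c` is algebraic, `[L(c) : L]` bounds the degrees of all roots, so `L` would already
    -- contain them. If `c` is transcendental, `L(c)` has no new elements algebraic over `L`.
    by_cases hc : IsAlgebraic L c
    · refine hNL (rpow_one_div_mem_of_natDegree_minpoly_le hr L hrL (Module.finrank L L⟮c⟯)
        (fun n hn => ?_) N hN)
      have : FiniteDimensional L L⟮c⟯ := adjoin.finiteDimensional hc.isIntegral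
      have := minpoly.natDegree_le (A := L) (⟨_, hall n hn⟩ : L⟮c⟯)
      rwa [← minpoly.algebraMap_eq (algebraMap L⟮c⟯ ℝ).injective] at this
    · exact hNL (mem_of_isAlgebraic_of_mem_adjoin_of_transcendental hc
        (hint N hN).isAlgebraic (hall N hN))

theorem exists_countable_subfield_list {r : ℝ} (hr : 0 < r) (L : Subfield ℝ) (hrL : r ∈ L)
    (hcount : (L : Set ℝ).Countable) (hL : ∃ N : ℕ, 0 < N ∧ r ^ ((1 : ℝ) / (N : ℝ)) ∉ L)
    (l : List ℝ) :
    ∃ L' : Subfield ℝ, L ≤ L' ∧ (∀ c ∈ l, c ∈ L') ∧ (L' : Set ℝ).Countable ∧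
      ∃ N : ℕ, 0 < N ∧ r ^ ((1 : ℝ) / (N : ℝ)) ∉ L' := by
  induction l with
  | nil => exact ⟨L, le_rfl, by simp, hcount, hL⟩
  | cons c l ih =>
    obtain ⟨L₁, h1, h2, h3, h4⟩ := ih
    obtain ⟨L₂, h5, h6, h7, h8⟩ := exists_countable_subfield_insert hr L₁ (h1 hrL) h3 h4 c
    refine ⟨L₂, h1.trans h5, ?_, h7, h8⟩
    intro d hd
    rcases List.mem_cons.1 hd with rfl | hd
    · exact h6
    · exact h5 (h2 d hd)

theorem isAlgebraic_of_mem_adjoinAllRoots {r : ℚ} (hr : 0 < r) {x : ℝ}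
    (hx : x ∈ adjoinAllRoots r) : IsAlgebraic ℚ x := by
  have : Algebra.IsAlgebraic ℚ (adjoinAllRoots r) := by
    refine isAlgebraic_adjoin ?_
    rintro _ ⟨n, hn, rfl⟩
    refine ⟨X ^ n - C r, monic_X_pow_sub_C _ hn.ne', ?_⟩
    rw [eval₂_sub, eval₂_X_pow, eval₂_C, rpow_one_div_pow (by exact_mod_cast hr.le) one_pos
      (one_mul _) hn]
    simp
  exact isAlgebraic_iff.1 (this.isAlgebraic ⟨x, hx⟩)

theorem countable_adjoinAllRoots {r : ℚ} (hr : 0 < r) :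
    (adjoinAllRoots r : Set ℝ).Countable :=
  (Algebraic.countable ℚ ℝ).mono fun _ hx => isAlgebraic_of_mem_adjoinAllRoots hr hx

end

/-! ### Functions that are rational near a transcendental point, at arguments of large degree -/

section

open Polynomial Filter Topology

/-- The real numbers that are not a root of a nonzero polynomial over `L` of degree at most `D`. -/
def degreeGT (L : Subfield ℝ) (D : ℕ) : Set ℝ :=
  {x | ∀ p : L[X], p ≠ 0 → p.natDegree ≤ D → aeval x p ≠ 0}

/-- The filter of the real numbers close to `x₀` and of large degree over `L`. -/
def genericFilter (L : Subfield ℝ) (x₀ : ℝ) : Filter ℝ :=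
  𝓝 x₀ ⊓ ⨅ D : ℕ, 𝓟 (degreeGT L D)

/-- Along the generic filter at `x₀`, the function `f` is a rational function over `L`. -/
def IsGenericallyRational (L : Subfield ℝ) (x₀ : ℝ) (f : ℝ → ℝ) : Prop :=
  ∃ p q : L[X], q ≠ 0 ∧ ∀ᶠ x in genericFilter L x₀, f x = aeval x p / aeval x q

theorem degreeGT_antitone (L : Subfield ℝ) : Antitone (degreeGT L) :=
  fun _ _ h _ hx p hp hpd => hx p hp (hpd.trans h)

theorem genericFilter_hasBasis (L : Subfield ℝ) (x₀ : ℝ) :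
    (genericFilter L x₀).HasBasis (fun i : ℝ × ℕ => 0 < i.1)
      fun i => Metric.ball x₀ i.1 ∩ degreeGT L i.2 := by
  have h := (Metric.nhds_basis_ball (x := x₀)).inf (hasBasis_iInf_principal
    (directed_of_isDirected_le (degreeGT_antitone L) : Directed (· ≥ ·) (degreeGT L)))
  refine h.to_hasBasis (fun i hi => ⟨i, hi.1, subset_rfl⟩) fun i hi => ⟨i, ⟨hi, trivial⟩, subset_rfl⟩

section

variable {L : Subfield ℝ} {x₀ : ℝ}

theorem eventually_aeval_ne_zero {p : L[X]} (hp : p ≠ 0) :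
    ∀ᶠ x in genericFilter L x₀, aeval x p ≠ 0 :=
  (genericFilter_hasBasis L x₀).eventually_iff.2
    ⟨(1, p.natDegree), one_pos, fun _ hx => hx.2 p hp le_rfl⟩

theorem Transcendental.mem_degreeGT (hx₀ : Transcendental L x₀) (D : ℕ) : x₀ ∈ degreeGT L D :=
  fun p hp _ h => hx₀ ⟨p, hp, h⟩

/-- A transcendental `x₀` belongs to every set of the filter, so whatever holds eventually holds at
`x₀`; in particular a generic rational expression is also valid at `x₀` itself. -/
theorem Transcendental.eventually_self (hx₀ : Transcendental L x₀) {P : ℝ → Prop}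
    (h : ∀ᶠ x in genericFilter L x₀, P x) : P x₀ := by
  obtain ⟨i, hi, hP⟩ := (genericFilter_hasBasis L x₀).eventually_iff.1 h
  exact hP ⟨Metric.mem_ball_self hi, hx₀.mem_degreeGT i.2⟩

theorem isGenericallyRational_const {a : ℝ} (ha : a ∈ L) :
    IsGenericallyRational L x₀ fun _ => a :=
  ⟨C ⟨a, ha⟩, 1, one_ne_zero, .of_forall fun x => by rw [aeval_C, map_one, div_one]; rfl⟩

theorem isGenericallyRational_id : IsGenericallyRational L x₀ fun x => x :=
  ⟨X, 1, one_ne_zero, .of_forall fun x => by simp⟩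

theorem IsGenericallyRational.add {f g : ℝ → ℝ} (hf : IsGenericallyRational L x₀ f)
    (hg : IsGenericallyRational L x₀ g) : IsGenericallyRational L x₀ fun x => f x + g x := by
  obtain ⟨p, q, hq, h⟩ := hf
  obtain ⟨p', q', hq', h'⟩ := hg
  refine ⟨p * q' + q * p', q * q', mul_ne_zero hq hq', ?_⟩
  filter_upwards [h, h', eventually_aeval_ne_zero hq, eventually_aeval_ne_zero hq'] with x h1 h2 h3 h4
  rw [h1, h2, div_add_div _ _ h3 h4]; simp

theorem IsGenericallyRational.sub {f g : ℝ → ℝ} (hf : IsGenericallyRational L x₀ f)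
    (hg : IsGenericallyRational L x₀ g) : IsGenericallyRational L x₀ fun x => f x - g x := by
  obtain ⟨p, q, hq, h⟩ := hf
  obtain ⟨p', q', hq', h'⟩ := hg
  refine ⟨p * q' - q * p', q * q', mul_ne_zero hq hq', ?_⟩
  filter_upwards [h, h', eventually_aeval_ne_zero hq, eventually_aeval_ne_zero hq'] with x h1 h2 h3 h4
  rw [h1, h2, div_sub_div _ _ h3 h4]; simp

theorem IsGenericallyRational.mul {f g : ℝ → ℝ} (hf : IsGenericallyRational L x₀ f)
    (hg : IsGenericallyRational L x₀ g) : IsGenericallyRational L x₀ fun x => f x * g x := by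
  obtain ⟨p, q, hq, h⟩ := hf
  obtain ⟨p', q', hq', h'⟩ := hg
  refine ⟨p * p', q * q', mul_ne_zero hq hq', ?_⟩
  filter_upwards [h, h'] with x h1 h2
  rw [h1, h2, div_mul_div_comm]; simp

theorem IsGenericallyRational.eventually_ne_zero (hx₀ : Transcendental L x₀) {f : ℝ → ℝ}
    (hf : IsGenericallyRational L x₀ f) (h0 : f x₀ ≠ 0) :
    ∀ᶠ x in genericFilter L x₀, f x ≠ 0 := by
  obtain ⟨p, q, hq, h⟩ := hf
  have hp : p ≠ 0 := by
    rintro rfl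
    exact h0 (by rw [hx₀.eventually_self h]; simp)
  filter_upwards [h, eventually_aeval_ne_zero hp, eventually_aeval_ne_zero hq] with x h1 h2 h3
  rw [h1]; exact div_ne_zero h2 h3

theorem IsGenericallyRational.eventually_eq_zero (hx₀ : Transcendental L x₀) {f : ℝ → ℝ}
    (hf : IsGenericallyRational L x₀ f) (h0 : f x₀ = 0) :
    ∀ᶠ x in genericFilter L x₀, f x = 0 := by
  obtain ⟨p, q, hq, h⟩ := hf
  have hp : p = 0 := by
    by_contra hp
    refine div_ne_zero (hx₀.eventually_self (eventually_aeval_ne_zero hp))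
      (hx₀.eventually_self (eventually_aeval_ne_zero hq)) ?_
    rw [← hx₀.eventually_self h, h0]
  filter_upwards [h] with x h1
  rw [h1, hp]; simp

theorem IsGenericallyRational.div (hx₀ : Transcendental L x₀) {f g : ℝ → ℝ}
    (hf : IsGenericallyRational L x₀ f) (hg : IsGenericallyRational L x₀ g) (h0 : g x₀ ≠ 0) :
    IsGenericallyRational L x₀ fun x => f x / g x := by
  obtain ⟨p, q, hq, h⟩ := hf
  obtain ⟨p', q', hq', h'⟩ := hg
  have hp' : p' ≠ 0 := by
    rintro rfl
    exact h0 (by rw [hx₀.eventually_self h']; simp)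
  refine ⟨p * q', q * p', mul_ne_zero hq hp', ?_⟩
  filter_upwards [h, h'] with x h1 h2
  rw [h1, h2, div_div_div_eq]; simp

/-- A zero at `x₀` forces the numerator to be the zero polynomial; otherwise continuity preserves
the strict sign. This handles the branch instructions. -/
theorem IsGenericallyRational.eventually_nonneg_iff (hx₀ : Transcendental L x₀) {f : ℝ → ℝ}
    (hf : IsGenericallyRational L x₀ f) :
    ∀ᶠ x in genericFilter L x₀, (0 ≤ f x ↔ 0 ≤ f x₀) := by
  by_cases h0 : f x₀ = 0
  · filter_upwards [hf.eventually_eq_zero hx₀ h0] with x hx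
    rw [hx, h0]
  obtain ⟨p, q, hq, h⟩ := hf
  have hcont : ContinuousAt (fun x : ℝ => aeval x p / aeval x q) x₀ :=
    (p.continuous_aeval.continuousAt).div q.continuous_aeval.continuousAt
      (hx₀.eventually_self (eventually_aeval_ne_zero hq))
  have hx := hx₀.eventually_self h
  rcases lt_or_gt_of_ne h0 with hneg | hpos
  · have h1 := (hcont.eventually_lt_const (hx ▸ hneg)).filter_mono
      (inf_le_left : genericFilter L x₀ ≤ 𝓝 x₀)
    filter_upwards [h, h1] with x h2 h3
    rw [h2]
    exact iff_of_false h3.not_ge hneg.not_ge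
  · have h1 := (hcont.eventually_const_lt (hx ▸ hpos)).filter_mono
      (inf_le_left : genericFilter L x₀ ≤ 𝓝 x₀)
    filter_upwards [h, h1] with x h2 h3
    rw [h2]
    exact iff_of_true h3.le hpos.le

/-- This is why the oracle gives no help. Either `p/q` is a constant, or a value `s ∈ S ⊆ L` at `x`
would make `x` a root of the nonzero polynomial `p - s q`, whose degree is bounded independently of
`s`. -/
theorem IsGenericallyRational.eventually_mem_iff (hx₀ : Transcendental L x₀) {S : Set ℝ}
    (hS : S ⊆ L) {f : ℝ → ℝ} (hf : IsGenericallyRational L x₀ f) :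
    ∀ᶠ x in genericFilter L x₀, (f x ∈ S ↔ f x₀ ∈ S) := by
  obtain ⟨p, q, hq, h⟩ := hf
  by_cases hc : ∃ c : L, p = C c * q
  · obtain ⟨c, rfl⟩ := hc
    have hconst : ∀ᶠ x in genericFilter L x₀, f x = c := by
      filter_upwards [h, eventually_aeval_ne_zero hq] with x h1 h2
      rw [h1, map_mul, mul_div_cancel_right₀ _ h2, aeval_C]; rfl
    filter_upwards [hconst] with x hx
    rw [hx, hx₀.eventually_self hconst]
  · push Not at hc
    have hnot : ∀ᶠ x in genericFilter L x₀, f x ∉ S := by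
      have hdeg : ∀ᶠ x in genericFilter L x₀, x ∈ degreeGT L (max p.natDegree q.natDegree) :=
        (genericFilter_hasBasis L x₀).eventually_iff.2 ⟨(1, _), one_pos, fun _ hx => hx.2⟩
      filter_upwards [h, hdeg, eventually_aeval_ne_zero hq] with x h1 h2 h3 h4
      refine h2 (p - C ⟨f x, hS h4⟩ * q) (sub_ne_zero.2 (hc _)) ?_ ?_
      · exact (natDegree_sub_le _ _).trans (max_le_max le_rfl (natDegree_C_mul_le _ _))
      · rw [map_sub, map_mul, aeval_C, sub_eq_zero]
        change _ = f x * _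
        rw [h1, div_mul_cancel₀ _ h3]
    filter_upwards [hnot] with x hx
    exact iff_of_false hx (hx₀.eventually_self hnot)

end

/-- There are elements of large degree over `L` in every interval. -/
theorem frequently_mem_adjoinAllRoots {r : ℚ} (hr : 0 < r) (L : Subfield ℝ)
    (hL : ∃ N : ℕ, 0 < N ∧ (r : ℝ) ^ ((1 : ℝ) / (N : ℝ)) ∉ L) (x₀ : ℝ) :
    ∃ᶠ x in genericFilter L x₀, x ∈ adjoinAllRoots r := by
  obtain ⟨N, hN, hNL⟩ := hL
  have hr' : (0 : ℝ) < r := by exact_mod_cast hr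
  rw [(genericFilter_hasBasis L x₀).frequently_iff]
  rintro ⟨ε, D⟩ hε
  have hbig : ∃ n : ℕ, 0 < n ∧ D < (minpoly L ((r : ℝ) ^ ((1 : ℝ) / (n : ℝ)))).natDegree := by
    by_contra! hcon
    exact hNL (rpow_one_div_mem_of_natDegree_minpoly_le hr' L (SubfieldClass.ratCast_mem L r) D
      hcon N hN)
  obtain ⟨n, hn, hD⟩ := hbig
  set a : ℝ := (r : ℝ) ^ ((1 : ℝ) / (n : ℝ)) with ha
  -- A rational translation moves the root `a` close to `x₀` without changing its degree over `L` or
  -- leaving the field.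
  obtain ⟨q, hq1, hq2⟩ := exists_rat_btwn (show x₀ - a - ε < x₀ - a by simpa using hε)
  refine ⟨a + q, ⟨?_, ?_⟩, ?_⟩
  · rw [Metric.mem_ball, Real.dist_eq, abs_lt]
    constructor <;> linarith
  · intro p hp hpD h0
    have hcomp : aeval a (p.comp (X + C (q : L))) = 0 := by
      rw [aeval_comp]
      simpa using h0
    have hne : p.comp (X + C (q : L)) ≠ 0 := by
      intro h
      apply hp
      have h2 := congrArg (fun g => g.comp (X - C (q : L))) h
      simpa [comp_assoc] using h2
    have hle := natDegree_le_of_dvd (minpoly.dvd L a hcomp) hne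
    rw [natDegree_comp, natDegree_X_add_C, mul_one] at hle
    exact absurd hD (not_lt.2 (hle.trans hpD))
  · exact add_mem (IntermediateField.subset_adjoin ℚ _ ⟨n, hn, ha⟩)
      (SubfieldClass.ratCast_mem _ q)

theorem exists_transcendental_of_countable (L : Subfield ℝ) (hL : (L : Set ℝ).Countable) :
    ∃ x : ℝ, Transcendental L x := by
  have : Countable L := hL
  by_contra! h
  refine Cardinal.not_countable_real ((Algebraic.countable L ℝ).mono fun x _ => ?_)
  exact not_not.1 (h x)

/-! ### Oracle computations near a transcendental input -/

namespace BSS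

/-- The real constants occurring in an instruction. -/
def Instr.constants : Instr → List ℝ
  | .load _ α _ _ => [α]
  | _ => []

theorem Config.query_mem_ofReals_iff (c : Config) (S : Set ℝ) :
    c.query ∈ ofReals S ↔ c.j = c.i + 1 ∧ c.reg (c.i : ℤ) ∈ S := by
  constructor
  · rintro ⟨x, hx, h⟩
    have hlen : c.j - c.i = 1 := by simpa [Config.query] using congrArg List.length h
    have hval : [c.reg (c.i : ℤ)] = [x] := by
      rw [← h, Config.query, hlen]; simp [List.range_succ]
    exact ⟨by omega, by simpa [List.cons.inj hval |>.1] using hx⟩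
  · rintro ⟨h, hx⟩
    refine ⟨_, hx, ?_⟩
    rw [Config.query, h]
    simp [List.range_succ]

/-- The configurations `C x` have the same label and copy-registers as `C x₀`, and registers that
are rational functions of `x`, generically in `x`. -/
structure IsGenericConfig (L : Subfield ℝ) (x₀ : ℝ) (C : ℝ → Config) : Prop where
  label : ∀ᶠ x in genericFilter L x₀, (C x).label = (C x₀).label
  i : ∀ᶠ x in genericFilter L x₀, (C x).i = (C x₀).i
  j : ∀ᶠ x in genericFilter L x₀, (C x).j = (C x₀).j
  reg : ∀ z, IsGenericallyRational L x₀ fun x => (C x).reg z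

theorem isGenericallyRational_update {L : Subfield ℝ} {x₀ : ℝ} {C : ℝ → Config}
    (hC : ∀ z, IsGenericallyRational L x₀ fun x => (C x).reg z) (s : ℤ) {f : ℝ → ℝ}
    (hf : IsGenericallyRational L x₀ f) (z : ℤ) :
    IsGenericallyRational L x₀ fun x => Function.update (C x).reg s (f x) z := by
  by_cases h : z = s
  · subst h; simpa using hf
  · simpa [Function.update_of_ne h] using hC z

/-- The value of an arithmetic operation, with the value `0` for a division by zero. -/
noncomputable def ArithOp.total : ArithOp → ℝ → ℝ → ℝ
  | .add, a, b => a + b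
  | .sub, a, b => a - b
  | .mul, a, b => a * b
  | .div, a, b => a / b

theorem isGenericallyRational_total {L : Subfield ℝ} {x₀ : ℝ} (hx₀ : Transcendental L x₀)
    (op : ArithOp) {f g : ℝ → ℝ} (hf : IsGenericallyRational L x₀ f)
    (hg : IsGenericallyRational L x₀ g) (h : op.eval (f x₀) (g x₀) ≠ none) :
    IsGenericallyRational L x₀ (fun x => op.total (f x) (g x)) ∧
      ∀ᶠ x in genericFilter L x₀, op.eval (f x) (g x) = some (op.total (f x) (g x)) := by
  cases op with
  | add => exact ⟨hf.add hg, .of_forall fun _ => rfl⟩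
  | sub => exact ⟨hf.sub hg, .of_forall fun _ => rfl⟩
  | mul => exact ⟨hf.mul hg, .of_forall fun _ => rfl⟩
  | div =>
    have h0 : g x₀ ≠ 0 := fun h0 => h (by simp [ArithOp.eval, h0])
    refine ⟨hf.div hx₀ hg h0, ?_⟩
    filter_upwards [hg.eventually_ne_zero hx₀ h0] with x hx
    simp [ArithOp.eval, ArithOp.total, hx]

/-- One instruction turns a generic configuration into a generic configuration. -/
theorem IsGenericConfig.exec {L : Subfield ℝ} {x₀ : ℝ} (hx₀ : Transcendental L x₀) {S : Set ℝ}
    (hS : S ⊆ L) {C : ℝ → Config} (hC : IsGenericConfig L x₀ C) {I : Instr}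
    (hI : ∀ α ∈ I.constants, α ∈ L) {c' : Config} (hc' : I.exec (ofReals S) (C x₀) = some c') :
    ∃ C' : ℝ → Config, C' x₀ = c' ∧ IsGenericConfig L x₀ C' ∧
      ∀ᶠ x in genericFilter L x₀, I.exec (ofReals S) (C x) = some (C' x) := by
  cases I with
  | arith s op k l u v =>
    obtain ⟨r, hr, hrc⟩ := Option.map_eq_some_iff.1 hc'
    obtain ⟨h1, h2⟩ := isGenericallyRational_total hx₀ op (hC.reg k) (hC.reg l)
      (by rw [hr]; simp)
    refine ⟨fun x => ⟨(C x).label + 1, u.eval (C x).i, v.eval (C x).j,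
      Function.update (C x).reg s (op.total ((C x).reg k) ((C x).reg l))⟩, ?_, ⟨?_, ?_, ?_, ?_⟩, ?_⟩
    · have h3 := hx₀.eventually_self h2
      rw [hr] at h3
      rw [← hrc, Option.some.inj h3]
    · filter_upwards [hC.label] with x hx using by simp [hx]
    · filter_upwards [hC.i] with x hx using by simp [hx]
    · filter_upwards [hC.j] with x hx using by simp [hx]
    · exact isGenericallyRational_update hC.reg s h1
    · filter_upwards [h2] with x hx
      simp [Instr.exec, hx]
  | load s α u v =>
    refine ⟨fun x => ⟨(C x).label + 1, u.eval (C x).i, v.eval (C x).j,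
      Function.update (C x).reg s α⟩, Option.some.inj hc', ⟨?_, ?_, ?_, ?_⟩, .of_forall fun _ => rfl⟩
    · filter_upwards [hC.label] with x hx using by simp [hx]
    · filter_upwards [hC.i] with x hx using by simp [hx]
    · filter_upwards [hC.j] with x hx using by simp [hx]
    · exact isGenericallyRational_update hC.reg s
        (isGenericallyRational_const (hI α (by simp [Instr.constants])))
  | branch t =>
    refine ⟨fun x => { C x with label := if 0 ≤ (C x).reg 0 then t else (C x).label + 1 },
      Option.some.inj hc', ⟨?_, hC.i, hC.j, hC.reg⟩, .of_forall fun _ => rfl⟩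
    filter_upwards [hC.label, (hC.reg 0).eventually_nonneg_iff hx₀] with x h1 h2
    simp [h1, h2]
  | copy =>
    refine ⟨fun x => { C x with
      label := (C x).label + 1,
      -- The addresses are frozen at their values for `x₀`, so that fixed registers are updated;
      -- eventually they equal the actual addresses.
      reg := Function.update (C x).reg ((C x₀).i : ℤ) ((C x).reg ((C x₀).j : ℤ)) },
      Option.some.inj hc', ⟨?_, hC.i, hC.j, ?_⟩, ?_⟩
    · filter_upwards [hC.label] with x hx using by simp [hx]
    · exact isGenericallyRational_update hC.reg _ (hC.reg _)
    · filter_upwards [hC.i, hC.j] with x h1 h2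
      simp [Instr.exec, h1, h2]
  | oracle t =>
    classical
    refine ⟨fun x => { C x with
      label := if (C x).query ∈ ofReals S then t else (C x).label + 1 },
      by simpa [Instr.exec] using hc', ⟨?_, hC.i, hC.j, hC.reg⟩,
      .of_forall fun x => by simp [Instr.exec]⟩
    filter_upwards [hC.label, hC.i, hC.j, (hC.reg (C x₀).i).eventually_mem_iff hx₀ hS]
      with x h1 h2 h3 h4
    simp [Config.query_mem_ofReals_iff, h1, h2, h3, h4]

theorem isGenericConfig_init {L : Subfield ℝ} {x₀ : ℝ} :
    IsGenericConfig L x₀ fun x => init [x] := by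
  refine ⟨.of_forall fun _ => rfl, .of_forall fun _ => rfl, .of_forall fun _ => rfl, fun z => ?_⟩
  have h0 : IsGenericallyRational L x₀ fun _ => 0 := isGenericallyRational_const (zero_mem L)
  have h1 : IsGenericallyRational L x₀ fun _ => 1 := isGenericallyRational_const (one_mem L)
  by_cases hz : z = 0
  · simpa [init, hz] using h1
  by_cases hz1 : z = 1
  · simpa [init, hz1] using isGenericallyRational_id (L := L) (x₀ := x₀)
  by_cases hpos : 0 < z
  · have : (z.toNat - 1) ≠ 0 := by omega
    obtain ⟨m, hm⟩ := Nat.exists_eq_succ_of_ne_zero this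
    simpa [init, hz, hpos, hm] using h0
  · simpa [init, hz, hpos] using h0

/-- A computation on a transcendental input is generic. -/
theorem exists_isGenericConfig {L : Subfield ℝ} {x₀ : ℝ} (hx₀ : Transcendental L x₀) {S : Set ℝ}
    (hS : S ⊆ L) {M : Machine} (hM : ∀ I ∈ M.code, ∀ α ∈ I.constants, α ∈ L) {c : Config}
    (hc : Relation.ReflTransGen (fun c₁ c₂ => M.step (ofReals S) c₁ = some c₂) (init [x₀]) c) :
    ∃ C : ℝ → Config, C x₀ = c ∧ IsGenericConfig L x₀ C ∧
      ∀ᶠ x in genericFilter L x₀,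
        Relation.ReflTransGen (fun c₁ c₂ => M.step (ofReals S) c₁ = some c₂) (init [x]) (C x) := by
  induction hc with
  | refl => exact ⟨_, rfl, isGenericConfig_init, .of_forall fun _ => .refl⟩
  | tail _ hstep ih =>
    obtain ⟨C, rfl, hC, hrun⟩ := ih
    obtain ⟨I, hI, hexec⟩ := Option.bind_eq_some_iff.1 hstep
    obtain ⟨C', h1, h2, h3⟩ := hC.exec hx₀ hS (hM I (List.mem_of_getElem? hI)) hexec
    refine ⟨C', h1, h2, ?_⟩
    filter_upwards [hrun, hC.label, h3] with x h4 h5 h6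
    refine h4.tail ?_
    rw [Machine.step, h5, hI]
    exact h6

theorem Machine.StopsIn.unique {M : Machine} {B : Problem} {y : Seq} {c c' : Config}
    (h : M.StopsIn B y c) (h' : M.StopsIn B y c') : c = c' := by
  have hfinal : ∀ {d e : Config}, d.label = M.code.length →
      Relation.ReflTransGen (fun c₁ c₂ => M.step B c₁ = some c₂) d e → d = e := by
    intro d e hd hde
    rcases hde.cases_head with h | ⟨f, hf, -⟩
    · exact h
    · simp [Machine.step, hd] at hf
  rcases Relation.ReflTransGen.total_of_right_unique
    (fun a b c hb hc => Option.some.inj (hb.symm.trans hc)) h.1 h'.1 with h1 | h1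
  · exact hfinal h.2 h1
  · exact (hfinal h'.2 h1).symm

/-- A set of reals that has elements of arbitrarily large degree over every finitely generated
extension of the field generated by `S`, generically, is not reducible to `S`. -/
theorem not_reducible_ofReals {A S : Set ℝ}
    (h : ∀ l : List ℝ, ∃ L : Subfield ℝ, S ⊆ L ∧ (∀ α ∈ l, α ∈ L) ∧ (L : Set ℝ).Countable ∧
      ∀ x₀, Transcendental L x₀ → x₀ ∉ A ∧ ∃ᶠ x in genericFilter L x₀, x ∈ A) :
    ¬ Reducible (ofReals A) (ofReals S) := by
  rintro ⟨M, hM⟩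
  obtain ⟨L, hS, hl, hcount, hL⟩ := h (M.code.flatMap Instr.constants)
  obtain ⟨x₀, hx₀⟩ := exists_transcendental_of_countable L hcount
  obtain ⟨hx₀A, hfreq⟩ := hL x₀ hx₀
  have hconst : ∀ I ∈ M.code, ∀ α ∈ I.constants, α ∈ L := fun I hI α hα =>
    hl α (List.mem_flatMap.2 ⟨I, hI, hα⟩)
  have hmem : ∀ x, [x] ∈ ofReals A ↔ x ∈ A := fun x => by simp [ofReals]
  obtain ⟨c, hfinal, hout⟩ := hM [x₀] trivial
  obtain ⟨C, hC0, hC, hrun⟩ := exists_isGenericConfig hx₀ hS hconst hfinal.1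
  have hzero : (C x₀).reg 1 = 0 := by
    have := hout.2 0 (by simp [charFun])
    simpa [charFun, hmem, hx₀A, hC0] using this
  -- An element of `A` on which the machine follows the run of `x₀` and stops with the output `0` of
  -- `x₀`.
  obtain ⟨x, hxA, hx1, hx2, hx3⟩ := (hfreq.and_eventually (hrun.and (hC.label.and
    ((hC.reg 1).eventually_eq_zero hx₀ hzero)))).exists
  obtain ⟨c', hfinal', hout'⟩ := hM [x] trivial
  have heq : C x = c' := Machine.StopsIn.unique ⟨hx1, by rw [hx2, hC0, hfinal.2]⟩ hfinal'
  have hone : c'.reg 1 = 1 := by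
    have := hout'.2 0 (by simp [charFun])
    simpa [charFun, hmem, hxA] using this
  rw [← heq, hx3] at hone
  exact zero_ne_one hone

theorem not_reducible_adjoinAllRoots {p q : ℕ} (hp : p.Prime) (hq : q.Prime) (hpq : p ≠ q) :
    ¬ Reducible (ofReals (adjoinAllRoots p : Set ℝ)) (ofReals (adjoinAllRoots q : Set ℝ)) := by
  have hp0 : (0 : ℚ) < p := by exact_mod_cast hp.pos
  have hq0 : (0 : ℚ) < q := by exact_mod_cast hq.pos
  refine not_reducible_ofReals fun l => ?_
  obtain ⟨L, h1, h2, h3, h4⟩ := exists_countable_subfield_list (r := ((p : ℚ) : ℝ))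
    -- The chain of fields starts at `adjoinAllRoots q`, which misses the root with `N = 2`, and
    -- absorbs the machine constants one by one.
    (by exact_mod_cast hp0) (adjoinAllRoots q).toSubfield (SubfieldClass.ratCast_mem _ _)
    (countable_adjoinAllRoots hq0) ⟨2, two_pos, fun h => by
      refine sqrt_prime_notMem_adjoinAllRoots hp hq hpq ?_
      rw [Real.sqrt_eq_rpow]
      exact_mod_cast h⟩ l
  refine ⟨L, h1, h2, h3, fun x₀ hx₀ => ⟨fun hmem => hx₀ ?_, frequently_mem_adjoinAllRoots hp0 L h4 x₀⟩⟩
  exact (isAlgebraic_of_mem_adjoinAllRoots hp0 hmem).extendScalars (algebraMap ℚ L).injective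

end BSS

end

/-! ### Algebraic numbers as words of Horner instructions, and words as digits -/

section

open Polynomial

/-- A real algebraic number is characterized by an equation and an inequality over `ℤ`. -/
theorem IsAlgebraic.exists_aeval_eq_zero_and_nonneg_iff {s : ℝ} (hs : IsAlgebraic ℚ s) :
    ∃ p r : ℤ[X], ∀ x : ℝ, (aeval x p = 0 ∧ 0 ≤ aeval x r) ↔ x = s := by
  obtain ⟨p, hp, hps⟩ := (IsFractionRing.isAlgebraic_iff ℤ ℚ ℝ).2 hs
  have hfin : ((p.rootSet ℝ) \ {s}).Finite := (p.rootSet_finite ℝ).subset Set.sdiff_subset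
  have hnhds : ((p.rootSet ℝ) \ {s})ᶜ ∈ nhds s := hfin.isClosed.isOpen_compl.mem_nhds (by simp)
  obtain ⟨l, u, ⟨hl, hu⟩, hlu⟩ := mem_nhds_iff_exists_Ioo_subset.1 hnhds
  -- Rationals `a < s < b` that isolate `s` from the other roots of `p`; the polynomial `r` below is
  -- a positive multiple of `(x - a)(b - x)`.
  obtain ⟨a, hla, has⟩ := exists_rat_btwn hl
  obtain ⟨b, hsb, hbu⟩ := exists_rat_btwn hu
  have hval : ∀ (x : ℝ) (q : ℚ), (q.den : ℝ) * x - q.num = q.den * (x - q) := by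
    intro x q
    rw [mul_sub, sub_right_inj]
    exact_mod_cast (Rat.den_mul_eq_num q).symm
  set r : ℤ[X] := (C (a.den : ℤ) * X - C a.num) * (C b.num - C (b.den : ℤ) * X) with hr
  have hrval : ∀ x : ℝ, aeval x r = (a.den * b.den : ℝ) * ((x - a) * (b - x)) := by
    intro x
    have h1 := hval x a
    have h2 := hval x b
    have h3 : aeval x r = ((a.den : ℝ) * x - a.num) * (b.num - b.den * x) := by
      simp [hr]
    rw [h3, h1, show (b.num : ℝ) - b.den * x = b.den * (b - x) by linarith]
    ring
  have hpos : (0 : ℝ) < a.den * b.den := by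
    have := a.den_pos
    have := b.den_pos
    positivity
  refine ⟨p, r, fun x => ⟨fun ⟨h0, h1⟩ => ?_, ?_⟩⟩
  · rw [hrval, mul_nonneg_iff_of_pos_left hpos] at h1
    have hax : (a : ℝ) ≤ x := by by_contra! h; nlinarith
    have hxb : x ≤ b := by by_contra! h; nlinarith
    by_contra hxs
    exact hlu ⟨hla.trans_le hax, hxb.trans_lt hbu⟩ ⟨(mem_rootSet).2 ⟨hp, h0⟩, hxs⟩
  · rintro rfl
    refine ⟨hps, ?_⟩
    rw [hrval]
    exact mul_nonneg hpos.le (mul_nonneg (sub_nonneg.2 has.le) (sub_nonneg.2 hsb.le))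

namespace BSS

/-- Instructions for the evaluation of integer polynomials by the Horner scheme. -/
inductive HornerOp : Type
  | mulX
  | succ
  | pred
  | store

/-- The effect of an instruction on the accumulator and the memory, for the argument `x`. -/
def HornerOp.apply (x e : ℝ) (v : ℝ × ℝ) : HornerOp → ℝ × ℝ
  | .mulX => (v.1 * x, v.2)
  | .succ => (v.1 + 1, v.2)
  | .pred => (v.1 - 1, v.2)
  | .store => (0, e - v.1 * v.1)

/-- Horner's scheme builds `p` by multiplications by `X` and additions of constants, and an integer
constant is added in unit steps. -/
theorem exists_horner (p : ℤ[X]) :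
    ∃ u : List HornerOp, ∀ x e m : ℝ, u.foldl (HornerOp.apply x e) (0, m) = (aeval x p, m) := by
  refine p.recOnHorner ⟨[], fun x e m => by simp⟩ ?_ ?_
  · intro p a _ _ ih
    -- `recOnHorner` also provides `a ≠ 0`, which would obstruct the induction on `a`.
    clear * - ih
    induction a using Int.induction_on with
    | zero => simpa using ih
    | succ i ih =>
      obtain ⟨u, hu⟩ := ih
      refine ⟨u ++ [.succ], fun x e m => ?_⟩
      rw [List.foldl_append, hu]
      simp [HornerOp.apply, add_assoc]
    | pred i ih =>
      obtain ⟨u, hu⟩ := ih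
      refine ⟨u ++ [.pred], fun x e m => ?_⟩
      rw [List.foldl_append, hu]
      simp [HornerOp.apply, add_sub_assoc]
  · rintro p _ ⟨u, hu⟩
    refine ⟨u ++ [.mulX], fun x e m => ?_⟩
    rw [List.foldl_append, hu]
    simp [HornerOp.apply]

/-- For `e ≤ 0` both results are nonnegative exactly if `e = 0`, `p(x) = 0` and `r(x) ≥ 0`. Thus two
sign tests check the equation, the inequality and, through `e`, the length of the input. -/
theorem exists_horner_pair (p r : ℤ[X]) :
    ∃ u : List HornerOp, ∀ x e : ℝ,
      u.foldl (HornerOp.apply x e) (0, e) = (aeval x r, e - aeval x p * aeval x p) := by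
  obtain ⟨u, hu⟩ := exists_horner p
  obtain ⟨v, hv⟩ := exists_horner r
  refine ⟨u ++ (.store :: v), fun x e => ?_⟩
  rw [List.foldl_append, hu, List.foldl_cons]
  exact hv x e _

/-- The successive positions in the concatenation of the words `W 0`, `W 1`, …: the number of the
current word, and what is left of it. -/
def position {T : Type} (W : ℕ → List T) : ℕ → ℕ × List T
  | 0 => (0, W 0)
  | n + 1 =>
    match position W n with
    | (k, []) => (k + 1, W (k + 1))
    | (k, _ :: t) => (k, t)

theorem exists_position_eq_nil {T : Type} (W : ℕ → List T) (k : ℕ) :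
    ∃ n, position W n = (k, []) := by
  have hword : ∀ (l : List T) (n k : ℕ), position W n = (k, l) → ∃ n, position W n = (k, []) := by
    intro l
    induction l with
    | nil => exact fun n k h => ⟨n, h⟩
    | cons a l ih => exact fun n k h => ih (n + 1) k (by rw [position, h])
  induction k with
  | zero => exact hword _ 0 0 rfl
  | succ k ih =>
    obtain ⟨n, hn⟩ := ih
    exact hword _ (n + 1) (k + 1) (by rw [position, hn])

/-- The accumulator and the memory while the words are executed; both are reset after each word. -/
def execWords (W : ℕ → List HornerOp) (x e : ℝ) : ℕ → ℝ × ℝ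
  | 0 => (0, e)
  | n + 1 =>
    match (position W n).2.head? with
    | none => (0, e)
    | some o => o.apply x e (execWords W x e n)

/-- The invariant of the execution: `u` is the part of the current word that has already been
executed. -/
theorem exists_append_position_eq (W : ℕ → List HornerOp) (x e : ℝ) (n : ℕ) :
    ∃ u, u ++ (position W n).2 = W (position W n).1 ∧
      execWords W x e n = u.foldl (HornerOp.apply x e) (0, e) := by
  induction n with
  | zero => exact ⟨[], rfl, rfl⟩
  | succ n ih =>
    obtain ⟨u, h1, h2⟩ := ih
    rw [position, execWords]
    rcases hpos : position W n with ⟨k, _ | ⟨o, t⟩⟩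
    · exact ⟨[], rfl, rfl⟩
    · rw [hpos] at h1
      refine ⟨u ++ [o], by simpa using h1, ?_⟩
      rw [List.foldl_append, ← h2]
      rfl

/-- The instruction sequence halts at the `n`-th position. -/
def AcceptsAt (W : ℕ → List HornerOp) (x e : ℝ) (n : ℕ) : Prop :=
  (position W n).2 = [] ∧ 0 ≤ (execWords W x e n).1 ∧ 0 ≤ (execWords W x e n).2

theorem exists_acceptsAt_iff (W : ℕ → List HornerOp) (x e : ℝ) :
    (∃ n, AcceptsAt W x e n) ↔ ∃ k, 0 ≤ ((W k).foldl (HornerOp.apply x e) (0, e)).1 ∧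
      0 ≤ ((W k).foldl (HornerOp.apply x e) (0, e)).2 := by
  constructor
  · rintro ⟨n, hn, h⟩
    obtain ⟨u, h1, h2⟩ := exists_append_position_eq W x e n
    rw [hn, List.append_nil] at h1
    rw [h2, h1] at h
    exact ⟨_, h⟩
  · rintro ⟨k, hk⟩
    obtain ⟨n, hn⟩ := exists_position_eq_nil W k
    obtain ⟨u, h1, h2⟩ := exists_append_position_eq W x e n
    rw [hn, List.append_nil] at h1
    refine ⟨n, by rw [hn], ?_⟩
    rw [h2, h1]
    exact hk

/-- The digit that encodes an instruction, or the end of a word. -/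
def digit : Option HornerOp → Fin 10
  | some .mulX => 0
  | some .succ => 1
  | some .pred => 2
  | some .store => 3
  | none => 4

/-- The real number that encodes the words from the `n`-th position on. -/
noncomputable def codeFrom (W : ℕ → List HornerOp) (n : ℕ) : ℝ :=
  Real.ofDigits fun i => digit (position W (i + n)).2.head?

/-- How a machine reads the code: multiplication by ten moves the next digit in front of the decimal
point. -/
theorem codeFrom_mul_ten (W : ℕ → List HornerOp) (n : ℕ) :
    codeFrom W n * 10 = (digit (position W n).2.head? : ℕ) + codeFrom W (n + 1) := by
  rw [codeFrom, Real.ofDigits_eq_sum_add_ofDigits _ 1, codeFrom]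
  simp only [Real.ofDigitsTerm, Finset.sum_range_one, zero_add, pow_one, add_assoc, add_comm 1 n]
  norm_num
  ring

theorem codeFrom_nonneg (W : ℕ → List HornerOp) (n : ℕ) : 0 ≤ codeFrom W n :=
  Real.ofDigits_nonneg _

/-- Only the digits `0` to `4` occur, which rules out `0.999… = 1`. Strictness is needed to
recognize a digit by comparisons. -/
theorem codeFrom_lt_one (W : ℕ → List HornerOp) (n : ℕ) : codeFrom W n < 1 := by
  have h1 := codeFrom_mul_ten W n
  have h2 : codeFrom W (n + 1) ≤ 1 := Real.ofDigits_le_one _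
  have h3 : ((digit (position W n).2.head? : ℕ) : ℝ) ≤ 4 := by
    have : (digit (position W n).2.head? : ℕ) ≤ 4 := by
      rcases (position W n).2.head? with _ | (_ | _ | _ | _) <;> decide
    exact_mod_cast this
  linarith

/-- The machine reaches a stop configuration from the configuration `c`. -/
def Machine.HaltsFrom (M : Machine) (c : Config) : Prop :=
  ∃ c', Relation.ReflTransGen (fun c₁ c₂ => M.step ∅ c₁ = some c₂) c c' ∧ c'.label = M.code.length

/-- The machine reaches `c'` from `c` in at least one step. -/
def Machine.Reaches (M : Machine) (c c' : Config) : Prop :=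
  Relation.TransGen (fun c₁ c₂ => M.step ∅ c₁ = some c₂) c c'

theorem Machine.Reaches.trans {M : Machine} {c c' c'' : Config} (h : M.Reaches c c')
    (h' : M.Reaches c' c'') : M.Reaches c c'' :=
  Relation.TransGen.trans h h'

theorem Machine.step_eq_none {M : Machine} {c : Config} (h : c.label = M.code.length) (B : Problem) :
    M.step B c = none := by
  simp [Machine.step, h]

theorem Machine.Reaches.haltsFrom_iff {M : Machine} {c c' : Config} (h : M.Reaches c c') :
    M.HaltsFrom c ↔ M.HaltsFrom c' := by
  constructor
  · rintro ⟨d, hd, hfinal⟩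
    refine ⟨d, ?_, hfinal⟩
    rcases Relation.ReflTransGen.total_of_right_unique
      (fun a b c hb hc => Option.some.inj (hb.symm.trans hc)) hd h.to_reflTransGen with h1 | h1
    · rcases h1.cases_head with h2 | ⟨f, hf, -⟩
      · rw [h2]
      · rw [Machine.step_eq_none hfinal] at hf
        cases hf
    · exact h1
  · rintro ⟨d, hd, hfinal⟩
    exact ⟨d, h.to_reflTransGen.trans hd, hfinal⟩

/-- A computation that returns to the set `P` again and again does not halt. -/
theorem Machine.not_haltsFrom {M : Machine} (P : Config → Prop)
    (hP : ∀ c, P c → ∃ c', M.Reaches c c' ∧ P c') {c : Config} (hc : P c) : ¬ M.HaltsFrom c := by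
  rintro ⟨d, hd, hfinal⟩
  -- Configurations between two visits to `P` need not lie in `P`; the property inherited along the
  -- run by determinism is that `P` can still be reached.
  have key : ¬ ∃ e, Relation.ReflTransGen (fun c₁ c₂ => M.step ∅ c₁ = some c₂) c e ∧ P e := by
    clear hc
    induction hd using Relation.ReflTransGen.head_induction_on with
    | refl =>
      rintro ⟨e, he, hPe⟩
      rcases he.cases_head with rfl | ⟨f, hf, -⟩
      · obtain ⟨c', h1, -⟩ := hP _ hPe
        obtain ⟨f, hf, -⟩ := Relation.TransGen.head'_iff.1 h1
        rw [Machine.step_eq_none hfinal] at hf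
        cases hf
      · rw [Machine.step_eq_none hfinal] at hf
        cases hf
    | head hstep _ ih =>
      rintro ⟨e, he, hPe⟩
      rcases he.cases_head with rfl | ⟨f, hf, hfe⟩
      · obtain ⟨c', h1, hPc'⟩ := hP _ hPe
        obtain ⟨f, hf, hfc'⟩ := Relation.TransGen.head'_iff.1 h1
        rw [hstep] at hf
        cases hf
        exact ih ⟨c', hfc', hPc'⟩
      · rw [hstep] at hf
        cases hf
        exact ih ⟨e, hfe, hPe⟩
  exact key ⟨c, .refl, hc⟩

end BSS

end

/-! ### The machine that interprets the digits of its constant -/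

section

open Polynomial

namespace BSS

/-- An arithmetic instruction that keeps the copy-registers. -/
def arithInstr (s : ℤ) (op : ArithOp) (k l : ℤ) : Instr := .arith s op k l .keep .keep

/-- A load instruction that keeps the copy-registers. -/
def loadInstr (s : ℤ) (α : ℝ) : Instr := .load s α .keep .keep

/-- A program that executes the words encoded by the digits of `α`. The register `x_0` holds the
digits still to be read, `x_{-1} = 1`, `x_{-2} = 10`, `x_{-3} = -(k - 1)^2` for an input of length
`k`, `x_{-4}` is the accumulator, `x_{-5}` the memory, `x_{-6}` a copy of `x_0`, and
`x_{-7} = 0`. -/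
def interpreterCode (α : ℝ) : List Instr :=
  [ loadInstr (-1) 1,
    loadInstr (-2) 10,
    arithInstr 0 .sub 0 (-1),
    arithInstr 0 .mul 0 0,
    arithInstr (-3) .sub (-7) 0,
    arithInstr (-5) .sub (-7) 0,
    loadInstr 0 α,
    -- Label 7, the main loop. Ones are subtracted from ten times the code until the result is
    -- negative, which identifies the digit. The last one is added back after the instruction has
    -- been executed, so that the branch to 7 is always taken.
    arithInstr 0 .mul 0 (-2),
    arithInstr 0 .sub 0 (-1),
    .branch 13,
    arithInstr (-4) .mul (-4) 1,
    arithInstr 0 .add 0 (-1),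
    .branch 7,
    arithInstr 0 .sub 0 (-1),
    .branch 18,
    arithInstr (-4) .add (-4) (-1),
    arithInstr 0 .add 0 (-1),
    .branch 7,
    arithInstr 0 .sub 0 (-1),
    .branch 23,
    arithInstr (-4) .sub (-4) (-1),
    arithInstr 0 .add 0 (-1),
    .branch 7,
    arithInstr 0 .sub 0 (-1),
    .branch 30,
    arithInstr (-5) .mul (-4) (-4),
    arithInstr (-5) .sub (-3) (-5),
    loadInstr (-4) 0,
    arithInstr 0 .add 0 (-1),
    .branch 7,
    -- Label 30, the end of a word. Only `x_0` can be tested, so the remaining code is saved first;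
    -- adding `x_{-7} = 0` serves as a copy.
    arithInstr (-6) .add 0 (-7),
    arithInstr 0 .add (-4) (-7),
    .branch 37,
    -- Label 33: accumulator and memory are reset, and the code is restored.
    loadInstr (-4) 0,
    arithInstr (-5) .add (-3) (-7),
    arithInstr 0 .add (-6) (-7),
    .branch 7,
    arithInstr 0 .add (-5) (-7),
    .branch 41,
    -- A zero in `x_0` makes the next jump unconditional. Label 41, the target of the preceding
    -- branch, is the stop label.
    loadInstr 0 0,
    .branch 33 ]

def interpreter (α : ℝ) : Machine where
  code := interpreterCode α
  valid := by
    simp [interpreterCode, arithInstr, loadInstr, Instr.targets]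

theorem interpreter_oracleFree (α : ℝ) : (interpreter α).OracleFree := by
  simp [Machine.OracleFree, interpreter, interpreterCode, arithInstr, loadInstr, Instr.IsOracle]

/-- The register contents of the interpreter on the input `y`. -/
noncomputable def interpreterReg (y : Seq) (e a acc m sv : ℝ) : ℤ → ℝ := fun z =>
  if z = 0 then a else if z = -1 then 1 else if z = -2 then 10 else if z = -3 then e else
  if z = -4 then acc else if z = -5 then m else if z = -6 then sv else (init y).reg z

/-- The configurations of the interpreter on the input `y`. -/
noncomputable def interpreterConfig (y : Seq) (e : ℝ) (n : ℕ) (a acc m sv : ℝ) : Config :=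
  ⟨n, 1, 1, interpreterReg y e a acc m sv⟩

section

variable {α : ℝ} {y : Seq} {e : ℝ}

theorem interpreterReg_update_zero (a acc m sv r : ℝ) :
    Function.update (interpreterReg y e a acc m sv) 0 r = interpreterReg y e r acc m sv := by
  ext z
  simp only [Function.update_apply, interpreterReg]
  split_ifs <;> rfl

theorem interpreterReg_update_acc (a acc m sv r : ℝ) :
    Function.update (interpreterReg y e a acc m sv) (-4) r = interpreterReg y e a r m sv := by
  ext z
  simp only [Function.update_apply, interpreterReg]
  split_ifs <;> first | rfl | omega

theorem interpreterReg_update_memory (a acc m sv r : ℝ) :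
    Function.update (interpreterReg y e a acc m sv) (-5) r = interpreterReg y e a acc r sv := by
  ext z
  simp only [Function.update_apply, interpreterReg]
  split_ifs <;> first | rfl | omega

theorem interpreterReg_update_copy (a acc m sv r : ℝ) :
    Function.update (interpreterReg y e a acc m sv) (-6) r = interpreterReg y e a acc m r := by
  ext z
  simp only [Function.update_apply, interpreterReg]
  split_ifs <;> first | rfl | omega

theorem reaches_arith {n : ℕ} {s k l : ℤ} {op : ArithOp} {a acc m sv a' acc' m' sv' : ℝ}
    (h : (interpreterCode α)[n]? = some (arithInstr s op k l))
    (hop : (op.eval (interpreterReg y e a acc m sv k) (interpreterReg y e a acc m sv l)).map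
      (Function.update (interpreterReg y e a acc m sv) s) =
        some (interpreterReg y e a' acc' m' sv')) :
    (interpreter α).Reaches (interpreterConfig y e n a acc m sv)
      (interpreterConfig y e (n + 1) a' acc' m' sv') := by
  obtain ⟨r, hr, hr'⟩ := Option.map_eq_some_iff.1 hop
  refine .single ?_
  simp only [Machine.step, interpreter, interpreterConfig, h, arithInstr, Instr.exec, AddrOp.eval,
    Option.bind_some, hr, Option.map_some, hr']

theorem reaches_load {n : ℕ} {s : ℤ} {β a acc m sv a' acc' m' sv' : ℝ}
    (h : (interpreterCode α)[n]? = some (loadInstr s β))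
    (hop : Function.update (interpreterReg y e a acc m sv) s β =
      interpreterReg y e a' acc' m' sv') :
    (interpreter α).Reaches (interpreterConfig y e n a acc m sv)
      (interpreterConfig y e (n + 1) a' acc' m' sv') := by
  refine .single ?_
  simp only [Machine.step, interpreter, interpreterConfig, h, loadInstr, Instr.exec, AddrOp.eval,
    Option.bind_some, hop]

theorem reaches_branch {n t : ℕ} {a acc m sv : ℝ}
    (h : (interpreterCode α)[n]? = some (.branch t)) (ha : 0 ≤ a) :
    (interpreter α).Reaches (interpreterConfig y e n a acc m sv)
      (interpreterConfig y e t a acc m sv) := by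
  refine .single ?_
  simp [Machine.step, interpreter, interpreterConfig, h, Instr.exec, interpreterReg, ha]

theorem reaches_branch_of_neg {n t : ℕ} {a acc m sv : ℝ}
    (h : (interpreterCode α)[n]? = some (.branch t)) (ha : a < 0) :
    (interpreter α).Reaches (interpreterConfig y e n a acc m sv)
      (interpreterConfig y e (n + 1) a acc m sv) := by
  refine .single ?_
  simp [Machine.step, interpreter, interpreterConfig, h, Instr.exec, interpreterReg, not_le.2 ha]

theorem reaches_decrement {n : ℕ} {a acc m sv : ℝ}
    (h : (interpreterCode α)[n]? = some (arithInstr 0 .sub 0 (-1))) :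
    (interpreter α).Reaches (interpreterConfig y e n a acc m sv)
      (interpreterConfig y e (n + 1) (a - 1) acc m sv) :=
  reaches_arith h (congrArg some (interpreterReg_update_zero ..))

/-- A digit that is not the one looked for at this place. -/
theorem reaches_next {n t : ℕ} {a acc m sv : ℝ}
    (h : (interpreterCode α)[n]? = some (arithInstr 0 .sub 0 (-1)))
    (h' : (interpreterCode α)[n + 1]? = some (.branch t)) (ha : 1 ≤ a) :
    (interpreter α).Reaches (interpreterConfig y e n a acc m sv)
      (interpreterConfig y e t (a - 1) acc m sv) :=
  (reaches_decrement h).trans (reaches_branch h' (sub_nonneg.2 ha))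

/-- The digit looked for at this place. -/
theorem reaches_found {n t : ℕ} {a acc m sv : ℝ}
    (h : (interpreterCode α)[n]? = some (arithInstr 0 .sub 0 (-1)))
    (h' : (interpreterCode α)[n + 1]? = some (.branch t)) (ha : a < 1) :
    (interpreter α).Reaches (interpreterConfig y e n a acc m sv)
      (interpreterConfig y e (n + 2) (a - 1) acc m sv) :=
  (reaches_decrement h).trans (reaches_branch_of_neg h' (sub_neg.2 ha))

theorem reaches_return {n : ℕ} {a acc m sv : ℝ}
    (h : (interpreterCode α)[n]? = some (arithInstr 0 .add 0 (-1)))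
    (h' : (interpreterCode α)[n + 1]? = some (.branch 7)) (ha : 0 ≤ a) :
    (interpreter α).Reaches (interpreterConfig y e n (a - 1) acc m sv)
      (interpreterConfig y e 7 a acc m sv) := by
  refine .trans (reaches_arith h ?_) (reaches_branch h' ha)
  refine congrArg some ((interpreterReg_update_zero ..).trans ?_)
  congr 1
  exact sub_add_cancel a 1

theorem reaches_mul_ten {a acc m sv : ℝ} :
    (interpreter α).Reaches (interpreterConfig y e 7 a acc m sv)
      (interpreterConfig y e 8 (a * 10) acc m sv) :=
  reaches_arith rfl (congrArg some (interpreterReg_update_zero ..))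

theorem reaches_mulX {a acc m sv f : ℝ} (ha : a * 10 = 0 + f) (h0 : 0 ≤ f) (h1 : f < 1) :
    (interpreter α).Reaches (interpreterConfig y e 7 a acc m sv)
      (interpreterConfig y e 7 f (acc * y.getD 0 0) m sv) := by
  have h := reaches_mul_ten (α := α) (y := y) (e := e) (a := a) (acc := acc) (m := m) (sv := sv)
  rw [ha, zero_add] at h
  refine h.trans ((reaches_found rfl rfl h1).trans (.trans ?_ (reaches_return (n := 11) rfl rfl h0)))
  exact reaches_arith rfl (congrArg some (interpreterReg_update_acc ..))

theorem reaches_succ {a acc m sv f : ℝ} (ha : a * 10 = 1 + f) (h0 : 0 ≤ f) (h1 : f < 1) :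
    (interpreter α).Reaches (interpreterConfig y e 7 a acc m sv)
      (interpreterConfig y e 7 f (acc + 1) m sv) := by
  refine reaches_mul_ten.trans ((reaches_next rfl rfl (by linarith)).trans ?_)
  rw [show a * 10 - 1 = f by linarith]
  refine .trans (reaches_found rfl rfl h1) (.trans ?_ (reaches_return (n := 16) rfl rfl h0))
  exact reaches_arith rfl (congrArg some (interpreterReg_update_acc ..))

theorem reaches_pred {a acc m sv f : ℝ} (ha : a * 10 = 2 + f) (h0 : 0 ≤ f) (h1 : f < 1) :
    (interpreter α).Reaches (interpreterConfig y e 7 a acc m sv)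
      (interpreterConfig y e 7 f (acc - 1) m sv) := by
  refine reaches_mul_ten.trans ((reaches_next rfl rfl (by linarith)).trans
    ((reaches_next rfl rfl (by linarith)).trans ?_))
  rw [show a * 10 - 1 - 1 = f by linarith]
  refine .trans (reaches_found rfl rfl h1) (.trans ?_ (reaches_return (n := 21) rfl rfl h0))
  exact reaches_arith rfl (congrArg some (interpreterReg_update_acc ..))

theorem reaches_store {a acc m sv f : ℝ} (ha : a * 10 = 3 + f) (h0 : 0 ≤ f) (h1 : f < 1) :
    (interpreter α).Reaches (interpreterConfig y e 7 a acc m sv)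
      (interpreterConfig y e 7 f 0 (e - acc * acc) sv) := by
  refine reaches_mul_ten.trans ((reaches_next rfl rfl (by linarith)).trans
    ((reaches_next rfl rfl (by linarith)).trans ((reaches_next rfl rfl (by linarith)).trans ?_)))
  rw [show a * 10 - 1 - 1 - 1 = f by linarith]
  refine .trans (reaches_found rfl rfl h1) (.trans (c' := interpreterConfig y e 28 (f - 1) 0
    (e - acc * acc) sv) ?_ (reaches_return rfl rfl h0))
  refine .trans (reaches_arith rfl (congrArg some (interpreterReg_update_memory ..)))
    (.trans (reaches_arith rfl (congrArg some (interpreterReg_update_memory ..)))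
      (reaches_load rfl (interpreterReg_update_acc ..)))

/-- At the end of a word, the sign of the accumulator is tested first. -/
theorem reaches_end {a acc m sv f : ℝ} (ha : a * 10 = 4 + f) (h0 : 0 ≤ f) :
    (interpreter α).Reaches (interpreterConfig y e 7 a acc m sv)
      (interpreterConfig y e 32 acc acc m f) := by
  refine reaches_mul_ten.trans ((reaches_next rfl rfl (by linarith)).trans
    ((reaches_next rfl rfl (by linarith)).trans ((reaches_next rfl rfl (by linarith)).trans
      ((reaches_next rfl rfl (by linarith)).trans ?_))))
  rw [show a * 10 - 1 - 1 - 1 - 1 = f by linarith]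
  refine .trans (c' := interpreterConfig y e 31 f acc m f) (reaches_arith rfl ?_)
    (reaches_arith rfl ?_)
  · refine congrArg some ((interpreterReg_update_copy ..).trans ?_)
    congr 1
    exact add_zero f
  · refine congrArg some ((interpreterReg_update_zero ..).trans ?_)
    congr 1
    exact add_zero acc

theorem reaches_memory_test {acc m sv : ℝ} (h : 0 ≤ acc) :
    (interpreter α).Reaches (interpreterConfig y e 32 acc acc m sv)
      (interpreterConfig y e 38 m acc m sv) := by
  refine .trans (reaches_branch rfl h) (reaches_arith rfl ?_)
  refine congrArg some ((interpreterReg_update_zero ..).trans ?_)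
  congr 1
  exact add_zero m

theorem reaches_reset {a acc m sv : ℝ} (h0 : 0 ≤ sv) :
    (interpreter α).Reaches (interpreterConfig y e 33 a acc m sv)
      (interpreterConfig y e 7 sv 0 e sv) := by
  refine .trans (reaches_load rfl (interpreterReg_update_acc ..))
    (.trans (c' := interpreterConfig y e 35 a 0 e sv) (reaches_arith rfl ?_)
      (.trans (c' := interpreterConfig y e 36 sv 0 e sv) (reaches_arith rfl ?_)
        (reaches_branch rfl h0)))
  · refine congrArg some ((interpreterReg_update_memory ..).trans ?_)
    congr 1
    exact add_zero e
  · refine congrArg some ((interpreterReg_update_zero ..).trans ?_)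
    congr 1
    exact add_zero sv

theorem reaches_accept {a acc m sv f : ℝ} (ha : a * 10 = 4 + f) (h0 : 0 ≤ f) (hacc : 0 ≤ acc)
    (hm : 0 ≤ m) :
    (interpreter α).Reaches (interpreterConfig y e 7 a acc m sv)
      (interpreterConfig y e 41 m acc m f) :=
  (reaches_end ha h0).trans ((reaches_memory_test hacc).trans (reaches_branch rfl hm))

theorem reaches_continue {a acc m sv f : ℝ} (ha : a * 10 = 4 + f) (h0 : 0 ≤ f)
    (h : ¬ (0 ≤ acc ∧ 0 ≤ m)) :
    (interpreter α).Reaches (interpreterConfig y e 7 a acc m sv)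
      (interpreterConfig y e 7 f 0 e f) := by
  refine (reaches_end ha h0).trans ?_
  by_cases hacc : 0 ≤ acc
  · have hm : m < 0 := not_le.1 fun hm => h ⟨hacc, hm⟩
    exact (reaches_memory_test hacc).trans ((reaches_branch_of_neg rfl hm).trans
      ((reaches_load rfl (interpreterReg_update_zero ..)).trans
        ((reaches_branch rfl le_rfl).trans (reaches_reset h0))))
  · exact (reaches_branch_of_neg rfl (not_le.1 hacc)).trans (reaches_reset h0)

/-- The configuration in which the instruction at the `n`-th position is executed. -/
noncomputable def wordConfig (W : ℕ → List HornerOp) (y : Seq) (e : ℝ) (n : ℕ) (sv : ℝ) : Config :=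
  interpreterConfig y e 7 (codeFrom W n) (execWords W (y.getD 0 0) e n).1
    (execWords W (y.getD 0 0) e n).2 sv

theorem haltsFrom_wordConfig {W : ℕ → List HornerOp} {n : ℕ} {sv : ℝ}
    (h : AcceptsAt W (y.getD 0 0) e n) : (interpreter α).HaltsFrom (wordConfig W y e n sv) := by
  have h1 := codeFrom_mul_ten W n
  rw [h.1] at h1
  have h2 := reaches_accept (α := α) (y := y) (e := e) (sv := sv)
    (by simpa [digit] using h1) (codeFrom_nonneg W (n + 1)) h.2.1 h.2.2
  exact ⟨_, h2.to_reflTransGen, rfl⟩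

theorem reaches_wordConfig {W : ℕ → List HornerOp} {n : ℕ} (sv : ℝ)
    (h : ¬ AcceptsAt W (y.getD 0 0) e n) :
    ∃ sv', (interpreter α).Reaches (wordConfig W y e n sv) (wordConfig W y e (n + 1) sv') := by
  have h1 := codeFrom_mul_ten W n
  have h2 := codeFrom_nonneg W (n + 1)
  have h3 := codeFrom_lt_one W (n + 1)
  simp only [wordConfig]
  rcases hw : (position W n).2 with _ | ⟨o, t⟩
  · refine ⟨codeFrom W (n + 1), ?_⟩
    rw [execWords, hw]
    rw [hw] at h1
    exact reaches_continue (by simpa [digit] using h1) h2 fun hc => h ⟨hw, hc⟩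
  · refine ⟨sv, ?_⟩
    rw [execWords, hw]
    rw [hw] at h1
    cases o
    · exact reaches_mulX (by simpa [digit] using h1) h2 h3
    · exact reaches_succ (by simpa [digit] using h1) h2 h3
    · exact reaches_pred (by simpa [digit] using h1) h2 h3
    · exact reaches_store (by simpa [digit] using h1) h2 h3

/-- A position that does not accept leads to the configuration of the next one, so without an
accepting position the run returns to label 7 forever. -/
theorem haltsFrom_wordConfig_zero_iff {W : ℕ → List HornerOp} {sv : ℝ} :
    (interpreter α).HaltsFrom (wordConfig W y e 0 sv) ↔ ∃ n, AcceptsAt W (y.getD 0 0) e n := by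
  constructor
  · intro h
    by_contra! hno
    refine Machine.not_haltsFrom (fun c => ∃ n sv, c = wordConfig W y e n sv) ?_ ⟨0, sv, rfl⟩ h
    rintro _ ⟨n, sv, rfl⟩
    obtain ⟨sv', h'⟩ := reaches_wordConfig (α := α) sv (hno n)
    exact ⟨_, h', n + 1, sv', rfl⟩
  · rintro ⟨n, hn⟩
    -- Going back from the accepting position `n`, an earlier position either accepts as well or
    -- leads to the next one. For `k ≥ n` the truncated subtraction stays at `0`.
    have key : ∀ k, ∀ sv, (interpreter α).HaltsFrom (wordConfig W y e (n - k) sv) := by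
      intro k
      induction k with
      | zero => exact fun sv => haltsFrom_wordConfig hn
      | succ k ih =>
        intro sv
        by_cases hk : k < n
        · by_cases hacc : AcceptsAt W (y.getD 0 0) e (n - (k + 1))
          · exact haltsFrom_wordConfig hacc
          · obtain ⟨sv', h'⟩ := reaches_wordConfig (α := α) sv hacc
            rw [show n - (k + 1) + 1 = n - k by omega] at h'
            exact h'.haltsFrom_iff.2 (ih sv')
        · rw [show n - (k + 1) = n - k by omega]
          exact ih sv
    simpa using key n sv

end

/-! ### Semi-decidability of countable sets of algebraic numbers -/

theorem reaches_wordConfig_zero (W : ℕ → List HornerOp) (y : Seq) :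
    (interpreter (codeFrom W 0)).Reaches (init y)
      (wordConfig W y (0 - (y.length - 1) * (y.length - 1)) 0 0) := by
  set α := codeFrom W 0
  have hstep : ∀ (n : ℕ) (I : Instr) (c c' : Config), (interpreterCode α)[n]? = some I →
      c.label = n → I.exec ∅ c = some c' → (interpreter α).Reaches c c' := by
    intro n I c c' hI hn h
    refine .single ?_
    rw [Machine.step, hn]
    exact (congrArg (fun o => o.bind (Instr.exec ∅ c)) hI).trans h
  -- The instructions before the main loop, executed one by one.
  refine .trans (hstep 0 _ _ _ rfl rfl rfl) (.trans (hstep 1 _ _ _ rfl rfl rfl)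
    (.trans (hstep 2 _ _ _ rfl rfl rfl) (.trans (hstep 3 _ _ _ rfl rfl rfl)
      (.trans (hstep 4 _ _ _ rfl rfl rfl) (.trans (hstep 5 _ _ _ rfl rfl rfl)
        (hstep 6 _ _ _ rfl rfl ?_))))))
  refine congrArg some ?_
  simp only [wordConfig, interpreterConfig, execWords]
  congr 1
  ext z
  simp only [Function.update_apply, interpreterReg]
  split_ifs <;> subst_vars <;> first | rfl | simp_all

/-- The enumeration `f` of `S` need not be effective, since the words for all its values are stored
in one real constant. -/
theorem semiDecidable_ofReals {S : Set ℝ} (hne : S.Nonempty) (hS : ∀ s ∈ S, IsAlgebraic ℚ s) :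
    SemiDecidable (ofReals S) := by
  have hcount : S.Countable := (Algebraic.countable ℚ ℝ).mono hS
  obtain ⟨f, rfl⟩ := hcount.exists_eq_range hne
  have hword : ∀ k, ∃ u : List HornerOp, ∀ x e : ℝ, e ≤ 0 →
      ((0 ≤ (u.foldl (HornerOp.apply x e) (0, e)).1 ∧
        0 ≤ (u.foldl (HornerOp.apply x e) (0, e)).2) ↔ (e = 0 ∧ x = f k)) := by
    intro k
    obtain ⟨p, r, hpr⟩ := (hS _ ⟨k, rfl⟩).exists_aeval_eq_zero_and_nonneg_iff
    obtain ⟨u, hu⟩ := exists_horner_pair p r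
    refine ⟨u, fun x e he => ?_⟩
    rw [hu, ← hpr]
    constructor
    · rintro ⟨h1, h2⟩
      have h3 := mul_self_nonneg (aeval x p)
      exact ⟨by linarith, mul_self_eq_zero.1 (by linarith), h1⟩
    · rintro ⟨rfl, h1, h2⟩
      exact ⟨h2, by simp [h1]⟩
  choose W hW using hword
  refine ⟨interpreter (codeFrom W 0), interpreter_oracleFree _, fun y => ?_⟩
  have h1 := (reaches_wordConfig_zero W y).haltsFrom_iff
  rw [haltsFrom_wordConfig_zero_iff, exists_acceptsAt_iff] at h1
  refine (show Machine.Halts _ _ y ↔ Machine.HaltsFrom _ (init y) from Iff.rfl).trans (h1.trans ?_)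
  -- This value of `e` vanishes only for inputs of length one; every other length fails all tests.
  have hle : (0 : ℝ) - (y.length - 1) * (y.length - 1) ≤ 0 := by
    have := mul_self_nonneg ((y.length : ℝ) - 1)
    linarith
  simp only [hW _ _ _ hle]
  have hlen : (0 : ℝ) - (y.length - 1) * (y.length - 1) = 0 ↔ y.length = 1 := by
    rw [zero_sub, neg_eq_zero, mul_self_eq_zero, sub_eq_zero]
    exact_mod_cast Iff.rfl
  rw [hlen]
  constructor
  · rintro ⟨k, hk, hy⟩
    obtain ⟨x, rfl⟩ := List.length_eq_one_iff.1 hk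
    exact ⟨x, ⟨k, hy.symm⟩, rfl⟩
  · rintro ⟨_, ⟨k, rfl⟩, rfl⟩
    exact ⟨k, rfl, rfl⟩

theorem semiDecidable_adjoinAllRoots {r : ℚ} (hr : 0 < r) :
    SemiDecidable (ofReals (adjoinAllRoots r : Set ℝ)) :=
  semiDecidable_ofReals ⟨0, zero_mem (adjoinAllRoots r)⟩ fun _ hs =>
    isAlgebraic_of_mem_adjoinAllRoots hr hs

end BSS

end

theorem mainTheorem2 :
    BSS.SemiDecidable (BSS.ofReals (adjoinAllRoots 2 : Set ℝ)) ∧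
    BSS.SemiDecidable (BSS.ofReals (adjoinAllRoots 3 : Set ℝ)) ∧
    BSS.Incomparable (BSS.ofReals (adjoinAllRoots 2 : Set ℝ))
      (BSS.ofReals (adjoinAllRoots 3 : Set ℝ)) := by
  refine ⟨BSS.semiDecidable_adjoinAllRoots two_pos, BSS.semiDecidable_adjoinAllRoots three_pos,
    ?_, ?_⟩
  · exact_mod_cast BSS.not_reducible_adjoinAllRoots Nat.prime_two Nat.prime_three (by decide)
  · exact_mod_cast BSS.not_reducible_adjoinAllRoots Nat.prime_three Nat.prime_two (by decide)
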